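/- For $\Re a>0$ and $x\in\mathbb C\setminus(-\infty,0]$ let $$\Psi(a,b;x)=\frac1{\Gamma(a)}\int_0^{e^{i\phi}\infty}e^{-xy}y^{a-1}(y+1)^{b-a-1}\,dy,\qquad \phi=-\arg x,$$ be the confluent hypergeometric function (principal powers; $-\pi<\phi<\pi$). For a sequence $\mathfrak A=\{a(l)\}_{l\ge1}$ of complex numbers put $$L_2(s_1,s_2;\mathfrak A)=\sum_{m,l\ge1}\frac{a(l)}{m^{s_1}(m+l)^{s_2}},\qquad F_\pm(s_1,s_2;\mathfrak A)=\sum_{l\ge1}\Big(\sum_{0<d\mid l}d^{\,s_1+s_2-1}a(d)\Big)\Psi(s_2,s_1+s_2;\pm2\pi il).$$ Fix an integer $n\ge1$ and let $\mathfrak A_0(n)$ be the sequence with $a(n)=1$ and $a(l)=0$ for all $l\ne n$. Then the integrals defining $\Psi(s_2,s_1+s_2;\pm 2\pi i l)$ converge absolutely for $\Re s_2>0$, $l\ge 1$, and the following hold. 1. For $\Re(s_1+s_2)>1$ the series converges absolutely and $$L_2(s_1,s_2;\mathfrak A_0(n))=\sum_{m\ge1}\frac1{m^{s_1}(m+n)^{s_2}}.$$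 2. For $\Re s_2>1$ the following series converge absolutely and $$F_\pm(s_1,s_2;\mathfrak A_0(n))=n^{s_1+s_2-1}\sum_{k\ge1}\Psi(s_2,s_1+s_2;\pm2\pi ikn).$$ 3. $L_2(s_1,s_2;\mathfrak A_0(n))$ and $F_\pm(s_1,s_2;\mathfrak A_0(n))$ have meromorphic continuations to $\mathbb C^2$. 4. For the continued functions and all $s_1,s_2\in\mathbb C$, except for singularity points (points at which one of $L_2(s_1,s_2;\mathfrak A_0(n))$, $F_\pm(1-s_2,1-s_1;\mathfrak A_0(n))$, $\Gamma(1-s_1)$, $\Gamma(s_1+s_2-1)$ is singular), $$L_2(s_1,s_2;\mathfrak A_0(n))=\frac{\Gamma(1-s_1)\Gamma(s_1+s_2-1)}{\Gamma(s_2)}\cdot\frac1{n^{s_1+s_2-1}}+\Gamma(1-s_1)\big\{F_+(1-s_2,1-s_1;\mathfrak A_0(n))+F_-(1-s_2,1-s_1;\mathfrak A_0(n))\big\}.$$ -/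

import Mathlib

open Filter Topology

noncomputable section

namespace EulerDouble

/-- `F : ℂ² → ℂ` is meromorphic on `ℂ²`: near every point it is a quotient `g / h` of two
holomorphic functions with `h` not identically zero near that point.  On the thin set `h = 0`
the value of `F` is not prescribed; the nonsingular points of `F` are the points at which `F`
is holomorphic (`AnalyticAt ℂ F p`). -/
def IsMeromorphic (F : ℂ × ℂ → ℂ) : Prop :=
  ∀ p : ℂ × ℂ, ∃ g h : ℂ × ℂ → ℂ, AnalyticAt ℂ g p ∧ AnalyticAt ℂ h p ∧
    (¬ ∀ᶠ q in 𝓝 p, h q = 0) ∧ ∀ᶠ q in 𝓝 p, h q ≠ 0 → F q = g q / h q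

/-- `F` is a meromorphic continuation to `ℂ²` of the function `f`, given on `D`. -/
def IsMeromorphicContinuation (f : ℂ × ℂ → ℂ) (D : Set (ℂ × ℂ)) (F : ℂ × ℂ → ℂ) : Prop :=
  IsMeromorphic F ∧ Set.EqOn F f D

/-- The integrand of the confluent hypergeometric integral
`∫ e^{-xy} y^{a-1} (y+1)^{b-a-1} dy`, pulled back to `t ∈ (0, ∞)` along the ray
`y = e^{iφ} t` with `φ = - arg x`.  For `x` off the half-line `(-∞, 0]` one has `-π < φ < π` and
`φ + arg x = 0`, and the principal powers are the intended ones. -/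
def psiIntegrand (a b x : ℂ) (t : ℝ) : ℂ :=
  let e : ℂ := Complex.exp (-(Complex.arg x : ℂ) * Complex.I)
  Complex.exp (-x * (e * t)) * (e * t) ^ (a - 1) * (e * t + 1) ^ (b - a - 1) * e

/-- The confluent hypergeometric function `Ψ(a, b; x)` for `Re a > 0` and `x` off `(-∞, 0]`. -/
def Psi (a b x : ℂ) : ℂ :=
  1 / Complex.Gamma a * ∫ t in Set.Ioi (0 : ℝ), psiIntegrand a b x t

/-- The term `a(n) / (m^{s₁} (m+n)^{s₂})`, at the pair `p = (m, n)` of positive integers. -/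
def L2Term (a : ℕ → ℂ) (s : ℂ × ℂ) (p : ℕ+ × ℕ+) : ℂ :=
  a p.2 / ((p.1 : ℂ) ^ s.1 * ((p.1 : ℂ) + (p.2 : ℂ)) ^ s.2)

/-- The double series `L₂(s₁, s₂; 𝔄)`, where it converges. -/
def L2Series (a : ℕ → ℂ) (s : ℂ × ℂ) : ℂ := ∑' p : ℕ+ × ℕ+, L2Term a s p

/-- `A_c(l) = ∑_{0 < d ∣ l} d^c a(d)`. -/
def divisorCoeff (a : ℕ → ℂ) (c : ℂ) (l : ℕ) : ℂ := ∑ d ∈ l.divisors, (d : ℂ) ^ c * a d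

/-- The point `2π i ε l`; it is used for `ε = 1` and `ε = -1`. -/
def psiPoint (ε : ℂ) (l : ℕ) : ℂ := ε * (2 * (Real.pi : ℂ) * Complex.I * l)

/-- The term `A_{s₁+s₂-1}(l) Ψ(s₂, s₁+s₂; 2π i ε l)`. -/
def FTerm (a : ℕ → ℂ) (ε : ℂ) (s : ℂ × ℂ) (l : ℕ+) : ℂ :=
  divisorCoeff a (s.1 + s.2 - 1) l * Psi s.2 (s.1 + s.2) (psiPoint ε l)

/-- The series `F_±(s₁, s₂; 𝔄)` (`ε = ± 1`), where it converges. -/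
def FSeries (a : ℕ → ℂ) (ε : ℂ) (s : ℂ × ℂ) : ℂ := ∑' l : ℕ+, FTerm a ε s l

/-- The sequence `𝔄₀(n)`: the `n`-th coefficient is `1` and all the others are `0`. -/
def A0 (n : ℕ) : ℕ → ℂ := fun j => if j = n then 1 else 0

/-- Region of absolute convergence of `L₂(s₁, s₂; 𝔄₀(n))`. -/
def regionL : Set (ℂ × ℂ) := {s | 1 < (s.1 + s.2).re}

/-- Region of absolute convergence of `F_±(s₁, s₂; 𝔄₀(n))`. -/
def regionF : Set (ℂ × ℂ) := {s | 1 < s.2.re}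

end EulerDouble

end

/-!
Both series are instances of one transform.  Let `ρ ≥ 0` and `x > 0` be functions on a measure space
such that `ρ x ^ σ (1 + x) ^ B` is integrable for all `σ > 1` and `B ≥ 0`, and let `|u| ≤ 1`,
`Re u ≥ 0`.  Put `J(w, s) = ∫ ρ x ^ w (1 + u x) ^ (-s)`, an integral that converges for `Re w > 1`.

* With `x = n / m` on the positive integers `m`, `ρ = 1` and `u = 1`, one has
  `L₂(s₁, s₂) = n ^ (-(s₁ + s₂)) J(s₁ + s₂, s₂)` (`L2Series_eq_integral`).
* On the ray of integration of `Ψ(s₂, s₁ + s₂; 2π i ε k n)` the exponential is real.  With the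
  logarithmic coordinate `v` on the ray, `x = e ^ v / (2π k n)` on the pairs `(k, v)`,
  `ρ = exp (-e ^ v)` and `u = -ε i`, the sum over `k` of these functions is
  `(-ε i) ^ s₂ / Γ(s₂) · J(s₂, 1 - s₁)` (`hasSum_Psi`).

The moments `∫ ρ x ^ w` are `n ^ w ζ(w)` and `(2π n) ^ (-w) ζ(w) Γ(w)`, so they are meromorphic
on `ℂ`.
Expanding `(1 + u x) ^ (-s)` to order `K` by the binomial formula writes `J` as a finite sum of
products of polynomials in `s` and shifted moments, plus the integral of a remainder that is
`O(x ^ K)`, which is holomorphic for `Re w + K > 1`.  As `K` is arbitrary, `J` continues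
meromorphically to `ℂ²` (`exists_isMeromorphic_mellin`).  Holomorphy in two variables of the
remainder integral rests on Osgood's lemma (`analyticAt_of_separately`).

For `Re s₁ < 0` and `Re (s₁ + s₂) > 1` all the series converge, and the functional equation is
Poisson's summation formula for `y ^ (-s₁) (y + n) ^ (-s₂)` on `y > 0`
(`functional_equation_of_convergent`).  The Fourier coefficient at `0` is an Euler beta integral,
and the one at `ε k ≠ 0` is `Γ(1 - s₁) Ψ(1 - s₁, 2 - s₁ - s₂; 2π i ε k n)` up to a power of `n`,
after the ray of integration is rotated to the real axis (`Gamma_mul_Psi_eq`).  The identity principle for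
meromorphic functions on `ℂ²` (`IsMeromorphic.eq_zero`) extends the equation to all nonsingular
points, for any choice of the continuations.
-/

noncomputable section

namespace EulerDouble

open MeasureTheory Metric

/-! ### Holomorphy in two variables -/

/-- Evaluation of the double circle integral on continuous functions on a torus, as a continuous
linear functional. -/
def torusFunctional (c d : ℂ) (R : ℝ) (hR : 0 ≤ R) :
    C(sphere c R × sphere d R, ℂ) →L[ℂ] ℂ :=
  LinearMap.mkContinuous
    { toFun := fun g => ∫ θ in (0 : ℝ)..2 * Real.pi, ∫ φ in (0 : ℝ)..2 * Real.pi,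
        deriv (circleMap c R) θ * (deriv (circleMap d R) φ *
          g (⟨circleMap c R θ, circleMap_mem_sphere c hR θ⟩,
             ⟨circleMap d R φ, circleMap_mem_sphere d hR φ⟩))
      map_add' := fun g h => by
        have key : ∀ k : C(sphere c R × sphere d R, ℂ), Continuous (fun x : ℝ × ℝ =>
            deriv (circleMap c R) x.1 * (deriv (circleMap d R) x.2 *
              k (⟨circleMap c R x.1, circleMap_mem_sphere c hR x.1⟩,
                ⟨circleMap d R x.2, circleMap_mem_sphere d hR x.2⟩))) := by
          intro k
          simp only [deriv_circleMap]
          fun_prop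
        rw [← intervalIntegral.integral_add]
        · congr 1; ext θ
          rw [← intervalIntegral.integral_add]
          · congr 1; ext φ; simp only [ContinuousMap.add_apply]; ring
          · exact ((key g).comp (Continuous.prodMk_right θ)).intervalIntegrable _ _
          · exact ((key h).comp (Continuous.prodMk_right θ)).intervalIntegrable _ _
        · exact (intervalIntegral.continuous_parametric_intervalIntegral_of_continuous'
            (key g) _ _).intervalIntegrable _ _
        · exact (intervalIntegral.continuous_parametric_intervalIntegral_of_continuous'
            (key h) _ _).intervalIntegrable _ _
      map_smul' := fun m g => by
        simp only [ContinuousMap.smul_apply, smul_eq_mul, RingHom.id_apply]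
        simp only [← intervalIntegral.integral_const_mul]
        congr 1; ext θ; congr 1; ext φ; ring }
    ((R * R * (2 * Real.pi)) * (2 * Real.pi)) (fun g => by
      have h2 : (2 * Real.pi) = |2 * Real.pi - 0| := by
        rw [sub_zero, abs_of_pos Real.two_pi_pos]
      have : ‖∫ θ in (0 : ℝ)..2 * Real.pi, ∫ φ in (0 : ℝ)..2 * Real.pi,
        deriv (circleMap c R) θ * (deriv (circleMap d R) φ *
          g (⟨circleMap c R θ, circleMap_mem_sphere c hR θ⟩,
             ⟨circleMap d R φ, circleMap_mem_sphere d hR φ⟩))‖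
          ≤ ((R * (R * ‖g‖)) * |2 * Real.pi - 0|) * |2 * Real.pi - 0| := by
        refine intervalIntegral.norm_integral_le_of_norm_le_const fun θ _ => ?_
        refine intervalIntegral.norm_integral_le_of_norm_le_const fun φ _ => ?_
        simp only [deriv_circleMap, norm_mul, norm_circleMap_zero, Complex.norm_I, mul_one,
          abs_of_nonneg hR]
        gcongr
        exact g.norm_coe_le_norm _
      rw [← h2] at this
      refine this.trans (le_of_eq ?_)
      ring)

/-- **Osgood's lemma**: a continuous, separately holomorphic function of two variables is analytic.
By Cauchy's formula it is a continuous linear functional of a product of three elements of the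
Banach algebra of continuous functions on a torus, two of which are resolvents. -/
theorem analyticAt_of_separately {F : ℂ × ℂ → ℂ} {U : Set (ℂ × ℂ)} (hU : IsOpen U)
    (hc : ContinuousOn F U)
    (h1 : ∀ p ∈ U, DifferentiableAt ℂ (fun z => F (z, p.2)) p.1)
    (h2 : ∀ p ∈ U, DifferentiableAt ℂ (fun w => F (p.1, w)) p.2) {p : ℂ × ℂ} (hp : p ∈ U) :
    AnalyticAt ℂ F p := by
  obtain ⟨c, d⟩ := p
  obtain ⟨R, hR, hRU⟩ := Metric.nhds_basis_closedBall.mem_iff.1 (hU.mem_nhds hp)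
  rw [← closedBall_prod_same] at hRU
  have hcU : ∀ z ∈ closedBall c R, ∀ w ∈ closedBall d R, (z, w) ∈ U := fun z hz w hw =>
    hRU ⟨hz, hw⟩
  let f : C(sphere c R × sphere d R, ℂ) := ⟨fun x => F (x.1, x.2), by
    have : Continuous (fun x : sphere c R × sphere d R => ((x.1 : ℂ), (x.2 : ℂ))) := by fun_prop
    exact hc.comp_continuous this fun x =>
      hcU _ (sphere_subset_closedBall x.1.2) _ (sphere_subset_closedBall x.2.2)⟩
  let π₁ : C(sphere c R × sphere d R, ℂ) := ⟨fun x => x.1, by fun_prop⟩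
  let π₂ : C(sphere c R × sphere d R, ℂ) := ⟨fun x => x.2, by fun_prop⟩
  have alg : ∀ (z : ℂ) (x : sphere c R × sphere d R),
      algebraMap ℂ C(sphere c R × sphere d R, ℂ) z x = z := fun _ _ => rfl
  have u1 : ∀ z ∈ ball c R, IsUnit (π₁ - algebraMap ℂ C(sphere c R × sphere d R, ℂ) z) := by
    intro z hz
    rw [ContinuousMap.isUnit_iff_forall_ne_zero]
    intro x hx
    have : (x.1 : ℂ) = z := sub_eq_zero.1 hx
    have h3 := x.1.2
    rw [this] at h3
    exact (ne_of_lt (mem_ball.1 hz)) (mem_sphere.1 h3)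
  have u2 : ∀ z ∈ ball d R, IsUnit (π₂ - algebraMap ℂ C(sphere c R × sphere d R, ℂ) z) := by
    intro z hz
    rw [ContinuousMap.isUnit_iff_forall_ne_zero]
    intro x hx
    have : (x.2 : ℂ) = z := sub_eq_zero.1 hx
    have h3 := x.2.2
    rw [this] at h3
    exact (ne_of_lt (mem_ball.1 hz)) (mem_sphere.1 h3)
  have inv_apply : ∀ g : C(sphere c R × sphere d R, ℂ), IsUnit g → ∀ x, Ring.inverse g x = (g x)⁻¹ := by
    intro g hg x
    have h : (g * Ring.inverse g) x = 1 := by rw [Ring.mul_inverse_cancel g hg]; rfl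
    exact eq_inv_of_mul_eq_one_right h
  have an : ∀ (π : C(sphere c R × sphere d R, ℂ)) (l : ℂ × ℂ →L[ℂ] ℂ) (q : ℂ × ℂ),
      IsUnit (π - algebraMap ℂ C(sphere c R × sphere d R, ℂ) (l q)) →
      AnalyticAt ℂ (fun p => Ring.inverse (π - algebraMap ℂ C(sphere c R × sphere d R, ℂ) (l p))) q := by
    intro π l q hq
    have h3 : AnalyticAt ℂ (Ring.inverse : C(sphere c R × sphere d R, ℂ) → C(sphere c R × sphere d R, ℂ)) (π - algebraMap ℂ C(sphere c R × sphere d R, ℂ) (l q)) := by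
      have := analyticAt_inverse (𝕜 := ℂ) hq.unit
      rwa [hq.unit_spec] at this
    have h4 : AnalyticAt ℂ (fun p => π - algebraMap ℂ C(sphere c R × sphere d R, ℂ) (l p)) q :=
      analyticAt_const.sub (((algebraMapCLM ℂ C(sphere c R × sphere d R, ℂ)).comp l).analyticAt q)
    exact AnalyticAt.comp (g := Ring.inverse)
      (f := fun p => π - algebraMap ℂ C(sphere c R × sphere d R, ℂ) (l p)) h3 h4
  let T := torusFunctional c d R hR.le
  -- Cauchy's formula in each variable, with the kernels written as inverses in the Banach algebra
  have key : ∀ q ∈ ball c R ×ˢ ball d R, F q = (2 * Real.pi * Complex.I : ℂ)⁻¹ *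
      ((2 * Real.pi * Complex.I : ℂ)⁻¹ * T (f * Ring.inverse (π₁ - algebraMap ℂ C(sphere c R × sphere d R, ℂ) q.1) *
        Ring.inverse (π₂ - algebraMap ℂ C(sphere c R × sphere d R, ℂ) q.2))) := by
    rintro ⟨z, w⟩ ⟨hz, hw⟩
    have c1 : (2 * Real.pi * Complex.I : ℂ)⁻¹ • ∮ ζ in C(c, R), (ζ - z)⁻¹ • F (ζ, w) = F (z, w) := by
      refine Complex.two_pi_I_inv_smul_circleIntegral_sub_inv_smul_of_differentiable_on_off_countable
        Set.countable_empty hz (f := fun ζ => F (ζ, w)) ?_ ?_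
      · exact fun x hx => (h1 (x, w) (hcU x hx w
          (ball_subset_closedBall hw))).continuousAt.continuousWithinAt
      · exact fun x hx => h1 (x, w) (hcU x (ball_subset_closedBall hx.1) w
          (ball_subset_closedBall hw))
    have c2 : ∀ ζ ∈ sphere c R, F (ζ, w) =
        (2 * Real.pi * Complex.I : ℂ)⁻¹ • ∮ η in C(d, R), (η - w)⁻¹ • F (ζ, η) := by
      intro ζ hζ
      have hζ' := sphere_subset_closedBall hζ
      refine (Complex.two_pi_I_inv_smul_circleIntegral_sub_inv_smul_of_differentiable_on_off_countable
        Set.countable_empty hw (f := fun η => F (ζ, η)) ?_ ?_).symm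
      · exact fun x hx => (h2 (ζ, x) (hcU ζ hζ' x hx)).continuousAt.continuousWithinAt
      · exact fun x hx => h2 (ζ, x) (hcU ζ hζ' x (ball_subset_closedBall hx.1))
    rw [← c1, smul_eq_mul]
    congr 1
    rw [circleIntegral.integral_congr hR.le
      (g := fun ζ => (2 * Real.pi * Complex.I : ℂ)⁻¹ • ((ζ - z)⁻¹ • ∮ η in C(d, R),
        (η - w)⁻¹ • F (ζ, η))) (fun ζ hζ => by
          dsimp only
          rw [c2 ζ hζ, smul_comm])]
    rw [circleIntegral.integral_smul, smul_eq_mul]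
    congr 1
    simp only [circleIntegral, T, torusFunctional]
    simp only [LinearMap.mkContinuous_apply, LinearMap.coe_mk, AddHom.coe_mk, smul_eq_mul,
      ContinuousMap.mul_apply, inv_apply _ (u1 z hz), inv_apply _ (u2 w hw)]
    congr 1; ext θ
    rw [← intervalIntegral.integral_const_mul, ← intervalIntegral.integral_const_mul]
    congr 1; ext φ
    simp only [ContinuousMap.sub_apply, alg, f, π₁, π₂,
      ContinuousMap.coe_mk]
    ring
  have hmem : ball c R ×ˢ ball d R ∈ 𝓝 (c, d) :=
    (isOpen_ball.prod isOpen_ball).mem_nhds ⟨mem_ball_self hR, mem_ball_self hR⟩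
  refine AnalyticAt.congr ?_ (Filter.eventuallyEq_of_mem hmem key).symm
  refine analyticAt_const.mul (analyticAt_const.mul ?_)
  refine (T.analyticAt _).comp ?_
  exact (analyticAt_const.mul (an π₁ (ContinuousLinearMap.fst ℂ ℂ ℂ) _ (u1 c (mem_ball_self hR)))).mul
    (an π₂ (ContinuousLinearMap.snd ℂ ℂ ℂ) _ (u2 d (mem_ball_self hR)))

/-- Differentiation under the integral sign for dominated families of holomorphic functions of one
variable; the bound on the derivative comes from Cauchy's estimate. -/
theorem differentiableAt_integral_of_dominated {α : Type*} [MeasurableSpace α] {μ : Measure α}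
    {f : ℂ → α → ℂ} {z₀ : ℂ} {bound : α → ℝ}
    (hmeas : ∀ᶠ z in 𝓝 z₀, AEStronglyMeasurable (f z) μ)
    (hbound : ∀ᶠ z in 𝓝 z₀, ∀ a, ‖f z a‖ ≤ bound a) (hint : Integrable bound μ)
    (hdiff : ∀ᶠ z in 𝓝 z₀, ∀ a, DifferentiableAt ℂ (fun z => f z a) z) :
    DifferentiableAt ℂ (fun z => ∫ a, f z a ∂μ) z₀ := by
  obtain ⟨R, hR, hRs⟩ := Metric.eventually_nhds_iff_ball.1 (hmeas.and (hbound.and hdiff))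
  have hR2 : 0 < R / 2 := by positivity
  have hsub : ∀ z ∈ ball z₀ (R / 2), closedBall z (R / 4) ⊆ ball z₀ R := by
    intro z hz
    refine closedBall_subset_ball' ?_
    have := mem_ball.1 hz
    linarith
  have hd : ∀ a, ∀ z ∈ ball z₀ (R / 2), ‖deriv (fun z => f z a) z‖ ≤ bound a / (R / 4) := by
    intro a z hz
    refine Complex.norm_deriv_le_of_forall_mem_sphere_norm_le (by positivity) ?_ ?_
    · refine DifferentiableOn.diffContOnCl ?_
      intro y hy
      exact ((hRs y (hsub z hz (closure_ball_subset_closedBall hy))).2.2 a).differentiableWithinAt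
    · intro y hy
      exact (hRs y (hsub z hz (sphere_subset_closedBall hy))).2.1 a
  -- the derivative is measurable as a limit of difference quotients along a sequence
  have hm : AEStronglyMeasurable (fun a => deriv (fun z => f z a) z₀) μ := by
    let u : ℕ → ℂ := fun n => ((R / (n + 2) : ℝ) : ℂ)
    have hu0 : Tendsto u atTop (𝓝 0) := by
      have h : Tendsto (fun n : ℕ => R / ((n : ℝ) + 2)) atTop (𝓝 0) :=
        tendsto_const_nhds.div_atTop
          (tendsto_atTop_add_const_right _ _ tendsto_natCast_atTop_atTop)
      have := (Complex.continuous_ofReal.tendsto 0).comp h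
      rwa [Complex.ofReal_zero] at this
    have hune : ∀ n, u n ≠ 0 := fun n => by
      simp only [u]
      rw [Complex.ofReal_ne_zero]
      positivity
    have hun : ∀ n, z₀ + u n ∈ ball z₀ R := by
      intro n
      rw [mem_ball, dist_self_add_left]
      simp only [u, Complex.norm_real, Real.norm_eq_abs]
      rw [abs_of_pos (by positivity), div_lt_iff₀ (by positivity)]
      nlinarith [n.cast_nonneg (α := ℝ)]
    refine aestronglyMeasurable_of_tendsto_ae (u := atTop)
      (f := fun n a => (u n)⁻¹ • (f (z₀ + u n) a - f z₀ a)) ?_ ?_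
    · intro n
      exact (((hRs _ (hun n)).1).sub ((hRs _ (mem_ball_self hR)).1)).const_smul (u n)⁻¹
    · refine Eventually.of_forall fun a => ?_
      have h := (((hRs z₀ (mem_ball_self hR)).2.2 a).hasDerivAt).tendsto_slope_zero
      refine h.comp (tendsto_nhdsWithin_iff.2 ⟨hu0, Eventually.of_forall hune⟩)
  refine (hasDerivAt_integral_of_dominated_loc_of_deriv_le (F := f)
    (F' := fun z a => deriv (fun z => f z a) z) (bound := fun a => bound a / (R / 4))
    (ball_mem_nhds z₀ hR2) hmeas ?_ hm ?_ (hint.div_const _) ?_).2.differentiableAt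
  · exact hint.mono' (hRs z₀ (mem_ball_self hR)).1
      (Eventually.of_forall (hRs z₀ (mem_ball_self hR)).2.1)
  · exact Eventually.of_forall hd
  · refine Eventually.of_forall fun a z hz => ?_
    exact ((hRs z (hsub z hz (mem_closedBall_self (by positivity)))).2.2 a).hasDerivAt

/-- An integral depending holomorphically on two complex parameters, with a locally uniform
integrable bound, is an analytic function of the parameters. -/
theorem analyticAt_integral_of_dominated {α : Type*} [MeasurableSpace α] {μ : Measure α}
    {f : ℂ × ℂ → α → ℂ} {U : Set (ℂ × ℂ)} (hU : IsOpen U)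
    (hmeas : ∀ p ∈ U, AEStronglyMeasurable (f p) μ)
    (hbound : ∀ p ∈ U, ∃ bound : α → ℝ, Integrable bound μ ∧ ∀ᶠ q in 𝓝 p, ∀ a, ‖f q a‖ ≤ bound a)
    (hdiff : ∀ p ∈ U, ∀ a, DifferentiableAt ℂ (fun q => f q a) p) {p : ℂ × ℂ} (hp : p ∈ U) :
    AnalyticAt ℂ (fun p => ∫ a, f p a ∂μ) p := by
  refine analyticAt_of_separately hU ?_ ?_ ?_ hp
  · intro q hq
    obtain ⟨b, hb, hb'⟩ := hbound q hq
    refine (continuousAt_of_dominated (bound := b) ?_ ?_ hb ?_).continuousWithinAt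
    · filter_upwards [hU.mem_nhds hq] with r hr using hmeas r hr
    · filter_upwards [hb'] with r hr using Eventually.of_forall hr
    · exact Eventually.of_forall fun a => (hdiff q hq a).continuousAt
  · rintro ⟨z, w⟩ hq
    obtain ⟨b, hb, hb'⟩ := hbound _ hq
    have ht : Tendsto (fun z' : ℂ => (z', w)) (𝓝 z) (𝓝 (z, w)) :=
      (Continuous.prodMk_left w).tendsto z
    refine differentiableAt_integral_of_dominated (f := fun z' => f (z', w)) ?_
      (ht.eventually hb') hb ?_
    · filter_upwards [ht (hU.mem_nhds hq)] with r hr using hmeas _ hr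
    · filter_upwards [ht (hU.mem_nhds hq)] with r hr a
      exact (hdiff _ hr a).comp r
        (differentiableAt_id.prodMk (differentiableAt_const w) : DifferentiableAt ℂ (fun z' => (z', w)) r)
  · rintro ⟨z, w⟩ hq
    obtain ⟨b, hb, hb'⟩ := hbound _ hq
    have ht : Tendsto (fun w' : ℂ => (z, w')) (𝓝 w) (𝓝 (z, w)) :=
      (Continuous.prodMk_right z).tendsto w
    refine differentiableAt_integral_of_dominated (f := fun w' => f (z, w')) ?_
      (ht.eventually hb') hb ?_
    · filter_upwards [ht (hU.mem_nhds hq)] with r hr using hmeas _ hr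
    · filter_upwards [ht (hU.mem_nhds hq)] with r hr a
      exact (hdiff _ hr a).comp r
        ((differentiableAt_const z).prodMk differentiableAt_id : DifferentiableAt ℂ (fun w' => (z, w')) r)

/-! ### Meromorphic functions of two variables -/

/-- The zero set of a nonzero analytic germ has no interior near the point. -/
theorem eventually_frequently_ne_zero {h : ℂ × ℂ → ℂ} {p : ℂ × ℂ} (hh : AnalyticAt ℂ h p)
    (hne : ¬ ∀ᶠ q in 𝓝 p, h q = 0) : ∀ᶠ q in 𝓝 p, ∃ᶠ r in 𝓝 q, h r ≠ 0 := by
  obtain ⟨ε, hε, hB⟩ := Metric.eventually_nhds_iff_ball.1 hh.eventually_analyticAt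
  filter_upwards [ball_mem_nhds p hε] with q hq hcon
  refine hne ?_
  have h0 : ∀ᶠ r in 𝓝 q, h r = 0 := hcon.mono fun r hr => not_not.1 hr
  have := AnalyticOnNhd.eqOn_zero_of_preconnected_of_eventuallyEq_zero (f := h) (U := ball p ε)
    (fun x hx => hB x hx) (convex_ball p ε).isPreconnected hq h0
  exact Filter.eventually_of_mem (ball_mem_nhds p hε) this

/-- The germs of analytic functions of two variables form an integral domain. -/
theorem eventually_eq_zero_of_mul {f₁ f₂ : ℂ × ℂ → ℂ} {p : ℂ × ℂ} (h1 : AnalyticAt ℂ f₁ p)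
    (h2 : AnalyticAt ℂ f₂ p) (h : ∀ᶠ q in 𝓝 p, f₁ q * f₂ q = 0)
    (hne : ¬ ∀ᶠ q in 𝓝 p, f₂ q = 0) : ∀ᶠ q in 𝓝 p, f₁ q = 0 := by
  by_contra hne1
  have hf : ∃ᶠ q in 𝓝 p, f₂ q ≠ 0 := not_eventually.1 hne
  obtain ⟨q, hq, hq1, hq2, hq3⟩ := (hf.and_eventually
    ((eventually_frequently_ne_zero h1 hne1).and
      (h.eventually_nhds.and h2.eventually_continuousAt))).exists
  obtain ⟨r, hr, hr1, hr2⟩ := (hq1.and_eventually (hq2.and (hq3.eventually_ne hq))).exists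
  exact (mul_ne_zero hr hr2) hr1

/-- `F` is meromorphic near the point `p`: the local condition in `IsMeromorphic`. -/
def IsMeromorphicNear (F : ℂ × ℂ → ℂ) (p : ℂ × ℂ) : Prop :=
  ∃ g h : ℂ × ℂ → ℂ, AnalyticAt ℂ g p ∧ AnalyticAt ℂ h p ∧
    (¬ ∀ᶠ q in 𝓝 p, h q = 0) ∧ ∀ᶠ q in 𝓝 p, h q ≠ 0 → F q = g q / h q

theorem IsMeromorphic.near {F : ℂ × ℂ → ℂ} (hF : IsMeromorphic F) (p : ℂ × ℂ) :
    IsMeromorphicNear F p := hF p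

theorem _root_.AnalyticAt.isMeromorphicNear {F : ℂ × ℂ → ℂ} {p : ℂ × ℂ} (h : AnalyticAt ℂ F p) :
    IsMeromorphicNear F p :=
  ⟨F, fun _ => 1, h, analyticAt_const, fun h => one_ne_zero h.self_of_nhds, by simp⟩

namespace IsMeromorphicNear

variable {F G : ℂ × ℂ → ℂ} {p : ℂ × ℂ}

theorem congr (hF : IsMeromorphicNear F p) (h : ∀ᶠ q in 𝓝 p, G q = F q) :
    IsMeromorphicNear G p := by
  obtain ⟨g, k, hg, hk, hne, he⟩ := hF
  refine ⟨g, k, hg, hk, hne, ?_⟩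
  filter_upwards [he, h] with q h1 h2 h3
  rw [h2, h1 h3]

theorem mul (hF : IsMeromorphicNear F p) (hG : IsMeromorphicNear G p) :
    IsMeromorphicNear (fun q => F q * G q) p := by
  obtain ⟨g₁, h₁, hg₁, hh₁, hne₁, he₁⟩ := hF
  obtain ⟨g₂, h₂, hg₂, hh₂, hne₂, he₂⟩ := hG
  refine ⟨fun q => g₁ q * g₂ q, fun q => h₁ q * h₂ q, hg₁.mul hg₂, hh₁.mul hh₂,
    fun h => hne₁ (eventually_eq_zero_of_mul hh₁ hh₂ h hne₂), ?_⟩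
  filter_upwards [he₁, he₂] with q e1 e2 h3
  rw [e1 (left_ne_zero_of_mul h3), e2 (right_ne_zero_of_mul h3), div_mul_div_comm]

theorem add (hF : IsMeromorphicNear F p) (hG : IsMeromorphicNear G p) :
    IsMeromorphicNear (fun q => F q + G q) p := by
  obtain ⟨g₁, h₁, hg₁, hh₁, hne₁, he₁⟩ := hF
  obtain ⟨g₂, h₂, hg₂, hh₂, hne₂, he₂⟩ := hG
  refine ⟨fun q => g₁ q * h₂ q + h₁ q * g₂ q, fun q => h₁ q * h₂ q,
    (hg₁.mul hh₂).add (hh₁.mul hg₂), hh₁.mul hh₂,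
    fun h => hne₁ (eventually_eq_zero_of_mul hh₁ hh₂ h hne₂), ?_⟩
  filter_upwards [he₁, he₂] with q e1 e2 h3
  rw [e1 (left_ne_zero_of_mul h3), e2 (right_ne_zero_of_mul h3),
    div_add_div _ _ (left_ne_zero_of_mul h3) (right_ne_zero_of_mul h3)]

theorem sum {ι : Type*} (s : Finset ι) {f : ι → ℂ × ℂ → ℂ}
    (h : ∀ i ∈ s, IsMeromorphicNear (f i) p) : IsMeromorphicNear (fun q => ∑ i ∈ s, f i q) p := by
  classical
  induction s using Finset.induction_on with
  | empty => simpa using (analyticAt_const (v := (0 : ℂ)) (x := p)).isMeromorphicNear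
  | insert a s ha ih =>
    simp only [Finset.sum_insert ha]
    exact (h a (Finset.mem_insert_self a s)).add
      (ih fun i hi => h i (Finset.mem_insert_of_mem hi))

end IsMeromorphicNear

/-- Meromorphy is preserved under analytic changes of coordinates. -/
theorem IsMeromorphic.comp_homeomorph {F : ℂ × ℂ → ℂ} (hF : IsMeromorphic F)
    (φ : ℂ × ℂ ≃ₜ ℂ × ℂ) (hφ : ∀ p, AnalyticAt ℂ φ p) : IsMeromorphic (fun q => F (φ q)) := by
  intro p
  obtain ⟨g, h, hg, hh, hne, he⟩ := hF (φ p)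
  refine ⟨fun q => g (φ q), fun q => h (φ q), AnalyticAt.fun_comp hg (hφ p),
    AnalyticAt.fun_comp hh (hφ p), fun h0 => hne ?_, φ.continuous.continuousAt.eventually he⟩
  rw [← φ.map_nhds_eq]
  exact h0

/-- A meromorphic function of one variable, evaluated at an affine functional `A q + c`. -/
theorem isMeromorphic_comp_affine {f : ℂ → ℂ} (hf : ∀ z, MeromorphicAt f z)
    (A : ℂ × ℂ →L[ℂ] ℂ) (c : ℂ) {v : ℂ × ℂ} (hv : A v = 1) :
    IsMeromorphic (fun q => f (A q + c)) := by
  intro p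
  obtain ⟨n, hn⟩ := hf (A p + c)
  have hA : AnalyticAt ℂ (fun q => A q + c) p := (A.analyticAt p).add analyticAt_const
  refine ⟨fun q => (A q + c - (A p + c)) ^ n * f (A q + c), fun q => (A q + c - (A p + c)) ^ n,
    AnalyticAt.fun_comp (g := fun z => (z - (A p + c)) ^ n • f z) hn hA,
    (hA.sub analyticAt_const).pow n, fun h0 => ?_, ?_⟩
  · have ht : Tendsto (fun t : ℂ => p + t • v) (𝓝[≠] 0) (𝓝 p) := by
      have : Continuous (fun t : ℂ => p + t • v) := by fun_prop
      have := this.tendsto 0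
      rw [zero_smul, add_zero] at this
      exact this.mono_left nhdsWithin_le_nhds
    obtain ⟨t, ht1, ht2⟩ := ((ht.eventually h0).and self_mem_nhdsWithin).exists
    have := eq_zero_of_pow_eq_zero ht1
    simp only [map_add, map_smul, hv, smul_eq_mul, mul_one] at this
    refine ht2 ?_
    rw [Set.mem_singleton_iff, ← this]
    ring
  · exact Eventually.of_forall fun q hq => (mul_div_cancel_left₀ _ hq).symm

/-- **Identity principle**: a meromorphic function on `ℂ²` that vanishes on a nonempty open set
vanishes at every point where it is continuous.  The set of points near which the function
vanishes off the zero set of some nonzero analytic germ is open and closed. -/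
theorem IsMeromorphic.eq_zero {G : ℂ × ℂ → ℂ} (hG : IsMeromorphic G) {D : Set (ℂ × ℂ)}
    (hD : IsOpen D) (hDne : D.Nonempty) (h0 : ∀ q ∈ D, G q = 0) {p : ℂ × ℂ}
    (hp : ContinuousAt G p) : G p = 0 := by
  let U : Set (ℂ × ℂ) := {p | ∃ h : ℂ × ℂ → ℂ, AnalyticAt ℂ h p ∧ (¬ ∀ᶠ q in 𝓝 p, h q = 0) ∧
    ∀ᶠ q in 𝓝 p, h q ≠ 0 → G q = 0}
  have hUo : IsOpen U := by
    rw [isOpen_iff_eventually]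
    rintro q ⟨h, hh, hne, he⟩
    filter_upwards [hh.eventually_analyticAt, eventually_frequently_ne_zero hh hne,
      he.eventually_nhds] with r h1 h2 h3
    exact ⟨h, h1, not_eventually.2 h2, h3⟩
  have hUc : IsClosed U := by
    rw [← closure_subset_iff_isClosed]
    intro q hq
    obtain ⟨g, h, hg, hh, hne, he⟩ := hG q
    obtain ⟨ε, hε, hB⟩ := Metric.eventually_nhds_iff_ball.1
      (hg.eventually_analyticAt.and (hh.eventually_analyticAt.and
        ((eventually_frequently_ne_zero hh hne).and he)))
    obtain ⟨r, hrB, k, hk, hkne, hke⟩ := mem_closure_iff.1 hq _ isOpen_ball (mem_ball_self hε)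
    have hgz : ∀ᶠ x in 𝓝 r, g x = 0 := by
      refine eventually_eq_zero_of_mul (hB r hrB).1 (hB r hrB).2.1 ?_
        (not_eventually.2 (hB r hrB).2.2.1)
      refine eventually_eq_zero_of_mul ((hB r hrB).1.mul (hB r hrB).2.1) hk ?_ hkne
      filter_upwards [hke, isOpen_ball.mem_nhds hrB] with x hx hxB
      by_cases hkx : k x = 0
      · rw [hkx, mul_zero]
      by_cases hhx : h x = 0
      · simp [hhx]
      have := (hB x hxB).2.2.2 hhx
      rw [hx hkx, eq_comm, div_eq_zero_iff] at this
      simp [this.resolve_right hhx]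
    have hgB := AnalyticOnNhd.eqOn_zero_of_preconnected_of_eventuallyEq_zero (f := g)
      (U := ball q ε) (fun x hx => (hB x hx).1) (convex_ball q ε).isPreconnected hrB hgz
    refine ⟨h, hh, hne, ?_⟩
    filter_upwards [ball_mem_nhds q hε] with x hx hhx
    rw [(hB x hx).2.2.2 hhx, hgB hx, Pi.zero_apply, zero_div]
  have hU : U = Set.univ := by
    refine IsClopen.eq_univ ⟨hUc, hUo⟩ ?_
    obtain ⟨q, hq⟩ := hDne
    refine ⟨q, fun _ => 1, analyticAt_const, fun h => one_ne_zero h.self_of_nhds, ?_⟩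
    filter_upwards [hD.mem_nhds hq] with r hr _ using h0 r hr
  obtain ⟨h, -, hne, he⟩ : p ∈ U := hU ▸ Set.mem_univ p
  by_contra hGp
  have hf : ∃ᶠ q in 𝓝 p, h q ≠ 0 := not_eventually.1 hne
  obtain ⟨q, hq, hq1, hq2⟩ := (hf.and_eventually (he.and (hp.eventually_ne hGp))).exists
  exact hq2 (hq1 hq)

theorem meromorphicAt_Gamma (z : ℂ) : MeromorphicAt Complex.Gamma z := by
  have : AnalyticAt ℂ (fun s => (Complex.Gamma s)⁻¹) z :=
    Complex.differentiable_one_div_Gamma.analyticAt z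
  exact this.meromorphicAt.inv.congr (Eventually.of_forall fun s => inv_inv _)

theorem meromorphicAt_riemannZeta (z : ℂ) : MeromorphicAt riemannZeta z := by
  by_cases hz : z = 1
  · subst hz
    -- multiplying by `s - 1` twice makes the value `0` assigned at `s = 1` the right one
    refine ⟨2, Complex.analyticAt_of_differentiable_on_punctured_nhds_of_continuousAt ?_ ?_⟩
    · filter_upwards [self_mem_nhdsWithin] with s hs
      have := differentiableAt_riemannZeta hs
      fun_prop
    · rw [continuousAt_iff_punctured_nhds]
      have h1 : Tendsto (fun s : ℂ => s - 1) (𝓝[≠] 1) (𝓝 0) := by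
        have : Continuous (fun s : ℂ => s - 1) := by fun_prop
        have := this.tendsto 1
        rw [sub_self] at this
        exact this.mono_left nhdsWithin_le_nhds
      have h2 := h1.mul riemannZeta_residue_one
      rw [zero_mul] at h2
      simp only [sub_self, smul_eq_mul]
      rw [zero_pow two_ne_zero, zero_mul]
      refine h2.congr fun s => by ring
  · exact (DifferentiableOn.analyticAt differentiableOn_riemannZeta
      (isOpen_compl_singleton.mem_nhds hz)).meromorphicAt

/-! ### Taylor expansion of `(1 + y) ^ (-s)` in the right half-plane -/

/-- The binomial coefficient `binom (-s) k`, as an entire function of `s`. -/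
def binomCoeff : ℕ → ℂ → ℂ
  | 0, _ => 1
  | k + 1, s => -s * binomCoeff k (s + 1) / (k + 1)

/-- The remainder of order `K` in the binomial expansion of `(1 + y) ^ (-s)`. -/
def binomRemainder (K : ℕ) (s y : ℂ) : ℂ :=
  (1 + y) ^ (-s) - ∑ k ∈ Finset.range K, binomCoeff k s * y ^ k

theorem differentiable_binomCoeff (k : ℕ) : Differentiable ℂ (binomCoeff k) := by
  induction k with
  | zero => exact differentiable_const 1
  | succ k ih =>
    have : binomCoeff (k + 1) = fun s => -s * binomCoeff k (s + 1) / (k + 1) := rfl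
    rw [this]
    fun_prop

theorem one_le_one_add_re {y : ℂ} (hy : 0 ≤ y.re) : 1 ≤ (1 + y).re := by simpa using hy

theorem one_add_mem_slitPlane {y : ℂ} (hy : 0 ≤ y.re) : 1 + y ∈ Complex.slitPlane :=
  Or.inl (zero_lt_one.trans_le (one_le_one_add_re hy))

theorem hasDerivAt_binomRemainder (K : ℕ) (s : ℂ) {y : ℂ} (hy : 0 ≤ y.re) :
    HasDerivAt (binomRemainder (K + 1) s) (-s * binomRemainder K (s + 1) y) y := by
  have h1 : HasDerivAt (fun y : ℂ => (1 + y) ^ (-s)) (-s * (1 + y) ^ (-s - 1) * 1) y :=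
    ((hasDerivAt_id y).const_add 1).cpow_const (one_add_mem_slitPlane hy)
  have h2 : HasDerivAt (fun y : ℂ => ∑ k ∈ Finset.range (K + 1), binomCoeff k s * y ^ k)
      (∑ k ∈ Finset.range (K + 1), binomCoeff k s * (k * y ^ (k - 1))) y :=
    HasDerivAt.fun_sum fun k _ => (hasDerivAt_pow k y).const_mul _
  refine (h1.sub h2).congr_deriv (Eq.symm ?_)
  rw [Finset.sum_range_succ', binomRemainder, mul_sub, Finset.mul_sum]
  congr 1
  · rw [mul_one]; congr 2; ring
  · simp only [Nat.cast_zero, zero_mul, mul_zero, add_zero]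
    refine Finset.sum_congr rfl fun k _ => ?_
    have : (k : ℂ) + 1 ≠ 0 := Nat.cast_add_one_ne_zero k
    rw [binomCoeff, Nat.add_sub_cancel]
    push_cast
    field_simp

theorem norm_one_add_cpow_le {R : ℝ} (hR : 0 ≤ R) {s y : ℂ} (hs : ‖s‖ ≤ R) (hy : 0 ≤ y.re) :
    ‖(1 + y) ^ (-s)‖ ≤ Real.exp (Real.pi * R) * (1 + ‖y‖) ^ R := by
  have h1 : 1 ≤ ‖1 + y‖ := (one_le_one_add_re hy).trans (Complex.re_le_norm _)
  have h2 : ‖1 + y‖ ≤ 1 + ‖y‖ := by simpa using norm_add_le (1 : ℂ) y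
  refine (Complex.norm_cpow_le _ _).trans ?_
  rw [div_eq_mul_inv, ← Real.exp_neg, mul_comm]
  gcongr
  · rw [← mul_neg]
    refine (le_abs_self _).trans ?_
    rw [abs_mul]
    gcongr
    · exact Complex.abs_arg_le_pi _
    · rw [abs_neg]
      exact (Complex.abs_im_le_norm _).trans (by rwa [norm_neg])
  · refine (Real.rpow_le_rpow_of_exponent_le h1 (?_ : (-s).re ≤ R)).trans ?_
    · exact ((le_abs_self _).trans (Complex.abs_re_le_norm _)).trans (by rwa [norm_neg])
    · exact Real.rpow_le_rpow (norm_nonneg _) h2 hR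

/-- The binomial remainder of order `K` is `O(|y| ^ K)` at `0` and grows at most polynomially in the
right half-plane, uniformly for `s` in a disc.  The derivative of one remainder is a multiple of
the preceding one. -/
theorem exists_norm_binomRemainder_le (K : ℕ) : ∀ R : ℝ, 0 ≤ R → ∃ C B : ℝ, 0 ≤ C ∧ 0 ≤ B ∧
    ∀ s : ℂ, ‖s‖ ≤ R → ∀ y : ℂ, 0 ≤ y.re →
      ‖binomRemainder K s y‖ ≤ C * (‖y‖ ^ K * (1 + ‖y‖) ^ B) := by
  induction K with
  | zero =>
    intro R hR
    refine ⟨Real.exp (Real.pi * R), R, (Real.exp_pos _).le, hR, fun s hs y hy => ?_⟩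
    simpa [binomRemainder] using norm_one_add_cpow_le hR hs hy
  | succ K ih =>
    intro R hR
    obtain ⟨C, B, hC, hB, h⟩ := ih (R + 1) (by positivity)
    refine ⟨R * C, B, by positivity, hB, fun s hs y hy => ?_⟩
    have hconv : Convex ℝ (closedBall (0 : ℂ) ‖y‖ ∩ {z : ℂ | 0 ≤ z.re}) :=
      (convex_closedBall _ _).inter (convex_halfSpace_re_ge 0)
    have h0 : binomRemainder (K + 1) s 0 = 0 := by
      simp [binomRemainder, Finset.sum_range_succ', binomCoeff]
    have := Convex.norm_image_sub_le_of_norm_hasDerivWithin_le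
      (f := binomRemainder (K + 1) s) (f' := fun z => -s * binomRemainder K (s + 1) z)
      (C := R * (C * (‖y‖ ^ K * (1 + ‖y‖) ^ B))) (x := 0) (y := y)
      (fun z hz => (hasDerivAt_binomRemainder K s hz.2).hasDerivWithinAt) ?_ hconv
      ⟨by simp, by simp⟩ ⟨by simp, hy⟩
    · rw [h0, sub_zero, sub_zero] at this
      refine this.trans (le_of_eq ?_)
      ring
    · intro z hz
      have hzy : ‖z‖ ≤ ‖y‖ := by simpa using hz.1
      rw [norm_mul, norm_neg]
      gcongr
      refine (h (s + 1) ?_ z hz.2).trans ?_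
      · exact (norm_add_le _ _).trans (by simpa using hs)
      · gcongr

/-! ### Continuation of generalized Mellin transforms -/

section Mellin

variable {α : Type*} {ρ x : α → ℝ} {u : ℂ}

/-- The integrand `ρ x ^ w r_K(s, u x)`, where `r_K` is the binomial remainder of order `K`;
for `K = 0` it is `ρ x ^ w (1 + u x) ^ (-s)`. -/
def mellinRemainder (ρ x : α → ℝ) (u : ℂ) (K : ℕ) (p : ℂ × ℂ) (a : α) : ℂ :=
  ρ a * (x a : ℂ) ^ p.1 * binomRemainder K p.2 (u * x a)

theorem mellinRemainder_zero (p : ℂ × ℂ) (a : α) :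
    mellinRemainder ρ x u 0 p a = ρ a * (x a : ℂ) ^ p.1 * (1 + u * x a) ^ (-p.2) := by
  simp [mellinRemainder, binomRemainder]

theorem mellinRemainder_succ (hx : ∀ a, 0 < x a) (K : ℕ) (p : ℂ × ℂ) (a : α) :
    mellinRemainder ρ x u K p a = mellinRemainder ρ x u (K + 1) p a +
      binomCoeff K p.2 * u ^ K * (ρ a * (x a : ℂ) ^ (p.1 + K)) := by
  have hxa : (x a : ℂ) ≠ 0 := Complex.ofReal_ne_zero.2 (hx a).ne'
  rw [mellinRemainder, mellinRemainder, binomRemainder, binomRemainder, Finset.sum_range_succ,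
    Complex.cpow_add _ _ hxa, Complex.cpow_natCast]
  ring

theorem differentiableAt_mellinRemainder (hx : ∀ a, 0 < x a) (hu : 0 ≤ u.re) (K : ℕ) (p : ℂ × ℂ)
    (a : α) : DifferentiableAt ℂ (fun q => mellinRemainder ρ x u K q a) p := by
  have hxa : (x a : ℂ) ≠ 0 := Complex.ofReal_ne_zero.2 (hx a).ne'
  have hre : 0 ≤ (u * x a).re := by
    rw [Complex.re_mul_ofReal]
    exact mul_nonneg hu (hx a).le
  have h1 : 1 + u * (x a : ℂ) ≠ 0 := Complex.slitPlane_ne_zero (one_add_mem_slitPlane hre)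
  unfold mellinRemainder binomRemainder
  refine DifferentiableAt.mul ?_ (DifferentiableAt.sub ?_ ?_)
  · exact (differentiableAt_const _).mul (differentiableAt_fst.const_cpow (Or.inl hxa))
  · exact differentiableAt_snd.neg.const_cpow (Or.inl h1)
  · refine DifferentiableAt.fun_sum fun k _ => ?_
    refine DifferentiableAt.mul ?_ (differentiableAt_const _)
    exact ((differentiable_binomCoeff k) p.2).comp p differentiableAt_snd

/-- A bound for the integrand that is uniform for `Re w` in an interval and `s` in a disc. -/
theorem exists_norm_mellinRemainder_le (hρ : ∀ a, 0 ≤ ρ a) (hx : ∀ a, 0 < x a) (hu : 0 ≤ u.re)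
    (hu1 : ‖u‖ ≤ 1) (K : ℕ) {R : ℝ} (hR : 0 ≤ R) {σ τ : ℝ} (hστ : σ ≤ τ) :
    ∃ C B : ℝ, 0 ≤ B ∧ ∀ p : ℂ × ℂ, σ ≤ p.1.re → p.1.re ≤ τ → ‖p.2‖ ≤ R → ∀ a,
      ‖mellinRemainder ρ x u K p a‖ ≤ C * (ρ a * x a ^ (σ + K) * (1 + x a) ^ B) := by
  obtain ⟨C, B, hC, hB, h⟩ := exists_norm_binomRemainder_le K R hR
  refine ⟨C, B + (τ - σ), by linarith, fun p h1 h2 h3 a => ?_⟩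
  have hxa := hx a
  have hre : 0 ≤ (u * x a).re := by
    rw [Complex.re_mul_ofReal]
    exact mul_nonneg hu hxa.le
  have hux : ‖u * x a‖ ≤ x a := by
    rw [norm_mul, Complex.norm_real, Real.norm_eq_abs, abs_of_pos hxa]
    exact mul_le_of_le_one_left hxa.le hu1
  have e1 : x a ^ p.1.re ≤ x a ^ σ * (1 + x a) ^ (τ - σ) := by
    rw [show p.1.re = σ + (p.1.re - σ) by ring, Real.rpow_add hxa]
    gcongr
    refine (Real.rpow_le_rpow hxa.le (by linarith : x a ≤ 1 + x a) (by linarith)).trans ?_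
    exact Real.rpow_le_rpow_of_exponent_le (by linarith) (by linarith)
  rw [mellinRemainder, norm_mul, norm_mul, Complex.norm_real, Real.norm_eq_abs,
    abs_of_nonneg (hρ a), Complex.norm_cpow_eq_rpow_re_of_pos hxa]
  calc ρ a * x a ^ p.1.re * ‖binomRemainder K p.2 (u * x a)‖
      ≤ ρ a * (x a ^ σ * (1 + x a) ^ (τ - σ)) * (C * (x a ^ K * (1 + x a) ^ B)) := by
        refine mul_le_mul (mul_le_mul_of_nonneg_left e1 (hρ a)) ((h _ h3 _ hre).trans ?_)
          (norm_nonneg _) (mul_nonneg (hρ a) (by positivity))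
        gcongr
    _ = C * (ρ a * x a ^ (σ + K) * (1 + x a) ^ (B + (τ - σ))) := by
        rw [Real.rpow_add hxa, Real.rpow_add (by linarith : 0 < 1 + x a), Real.rpow_natCast]
        ring

variable [MeasurableSpace α] {μ : Measure α}

theorem aestronglyMeasurable_mellinRemainder (hρm : Measurable ρ) (hxm : Measurable x) (K : ℕ)
    (p : ℂ × ℂ) : AEStronglyMeasurable (mellinRemainder ρ x u K p) μ := by
  refine Measurable.aestronglyMeasurable ?_
  unfold mellinRemainder binomRemainder
  fun_prop

theorem integrable_mellinRemainder (hρm : Measurable ρ) (hρ : ∀ a, 0 ≤ ρ a) (hxm : Measurable x)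
    (hx : ∀ a, 0 < x a) (hu : 0 ≤ u.re) (hu1 : ‖u‖ ≤ 1)
    (hint : ∀ σ B : ℝ, 1 < σ → 0 ≤ B → Integrable (fun a => ρ a * x a ^ σ * (1 + x a) ^ B) μ)
    {K : ℕ} {p : ℂ × ℂ} (hp : 1 < p.1.re + K) : Integrable (mellinRemainder ρ x u K p) μ := by
  obtain ⟨C, B, hB, h⟩ := exists_norm_mellinRemainder_le (ρ := ρ) hρ hx hu hu1 K
    (norm_nonneg p.2) (le_refl p.1.re)
  exact ((hint _ B hp hB).const_mul C).mono' (aestronglyMeasurable_mellinRemainder hρm hxm K p)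
    (Eventually.of_forall (h p le_rfl le_rfl le_rfl))

theorem analyticAt_integral_mellinRemainder (hρm : Measurable ρ) (hρ : ∀ a, 0 ≤ ρ a)
    (hxm : Measurable x) (hx : ∀ a, 0 < x a) (hu : 0 ≤ u.re) (hu1 : ‖u‖ ≤ 1)
    (hint : ∀ σ B : ℝ, 1 < σ → 0 ≤ B → Integrable (fun a => ρ a * x a ^ σ * (1 + x a) ^ B) μ)
    {K : ℕ} {p : ℂ × ℂ} (hp : 1 < p.1.re + K) :
    AnalyticAt ℂ (fun p => ∫ a, mellinRemainder ρ x u K p a ∂μ) p := by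
  have hc : Continuous (fun q : ℂ × ℂ => q.1.re) := Complex.continuous_re.comp continuous_fst
  have hU : IsOpen {q : ℂ × ℂ | 1 < q.1.re + K} :=
    isOpen_lt continuous_const (hc.add continuous_const)
  refine analyticAt_integral_of_dominated hU
    (fun q _ => aestronglyMeasurable_mellinRemainder hρm hxm K q) ?_
    (fun q _ a => differentiableAt_mellinRemainder hx hu K q a) hp
  intro q hq
  have hq' : 1 < q.1.re + K := hq
  obtain ⟨δ, hδ, hδ'⟩ : ∃ δ : ℝ, 0 < δ ∧ 1 < q.1.re - δ + K :=
    ⟨(q.1.re + K - 1) / 2, by linarith, by linarith⟩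
  obtain ⟨C, B, hB, h⟩ := exists_norm_mellinRemainder_le (ρ := ρ) hρ hx hu hu1 K
    (by positivity : 0 ≤ ‖q.2‖ + 1) (by linarith : q.1.re - δ ≤ q.1.re + δ)
  refine ⟨_, (hint _ B hδ' hB).const_mul C, ?_⟩
  have c2 : Continuous (fun q : ℂ × ℂ => ‖q.2‖) := continuous_snd.norm
  filter_upwards [hc.continuousAt.eventually (lt_mem_nhds (by linarith : q.1.re - δ < q.1.re)),
    hc.continuousAt.eventually (gt_mem_nhds (by linarith : q.1.re < q.1.re + δ)),
    c2.continuousAt.eventually (gt_mem_nhds (by linarith : ‖q.2‖ < ‖q.2‖ + 1))] with r h1 h2 h3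
  exact h r h1.le h2.le h3.le

/-- Continuation to the half-plane `1 < Re w + K` of `∫ ρ x ^ w (1 + u x) ^ (-s)`: the first `K`
terms of the binomial expansion are integrated by means of the continued moment function `M`. -/
def mellinContinuationAux (μ : Measure α) (ρ x : α → ℝ) (u : ℂ) (M : ℂ → ℂ) (K : ℕ)
    (p : ℂ × ℂ) : ℂ :=
  ∑ k ∈ Finset.range K, binomCoeff k p.2 * u ^ k * M (p.1 + k) +
    ∫ a, mellinRemainder ρ x u K p a ∂μ

/-- Passing from `K` to `K + 1` moves the term of order `K` from the integral to the sum, which is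
legitimate where its moment converges. -/
theorem mellinContinuationAux_succ (hρm : Measurable ρ) (hρ : ∀ a, 0 ≤ ρ a) (hxm : Measurable x)
    (hx : ∀ a, 0 < x a) (hu : 0 ≤ u.re) (hu1 : ‖u‖ ≤ 1)
    (hint : ∀ σ B : ℝ, 1 < σ → 0 ≤ B → Integrable (fun a => ρ a * x a ^ σ * (1 + x a) ^ B) μ)
    {M : ℂ → ℂ} (hM : ∀ w : ℂ, 1 < w.re → M w = ∫ a, ρ a * (x a : ℂ) ^ w ∂μ)
    {K : ℕ} {p : ℂ × ℂ} (hp : 1 < p.1.re + K) :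
    mellinContinuationAux μ ρ x u M (K + 1) p = mellinContinuationAux μ ρ x u M K p := by
  have hp1 : 1 < p.1.re + ((K + 1 : ℕ) : ℝ) := by push_cast; linarith
  have i1 := integrable_mellinRemainder hρm hρ hxm hx hu hu1 hint hp
  have i2 := integrable_mellinRemainder hρm hρ hxm hx hu hu1 hint hp1
  have e := integral_sub i1 i2
  have e2 : ∫ a, (mellinRemainder ρ x u K p a - mellinRemainder ρ x u (K + 1) p a) ∂μ =
      binomCoeff K p.2 * u ^ K * M (p.1 + K) := by
    rw [hM _ (by simpa using hp), ← integral_const_mul]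
    refine integral_congr_ae (Eventually.of_forall fun a => ?_)
    simp only [mellinRemainder_succ hx K p a]
    ring
  rw [e2] at e
  rw [mellinContinuationAux, mellinContinuationAux, Finset.sum_range_succ, e]
  ring

theorem mellinContinuationAux_eq (hρm : Measurable ρ) (hρ : ∀ a, 0 ≤ ρ a) (hxm : Measurable x)
    (hx : ∀ a, 0 < x a) (hu : 0 ≤ u.re) (hu1 : ‖u‖ ≤ 1)
    (hint : ∀ σ B : ℝ, 1 < σ → 0 ≤ B → Integrable (fun a => ρ a * x a ^ σ * (1 + x a) ^ B) μ)
    {M : ℂ → ℂ} (hM : ∀ w : ℂ, 1 < w.re → M w = ∫ a, ρ a * (x a : ℂ) ^ w ∂μ)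
    {K L : ℕ} (hKL : K ≤ L) {p : ℂ × ℂ} (hp : 1 < p.1.re + K) :
    mellinContinuationAux μ ρ x u M L p = mellinContinuationAux μ ρ x u M K p := by
  induction L, hKL using Nat.le_induction with
  | base => rfl
  | succ L hL ih =>
    have : (K : ℝ) ≤ L := by exact_mod_cast hL
    rw [mellinContinuationAux_succ hρm hρ hxm hx hu hu1 hint hM (by linarith), ih]

/-- If the moments `∫ ρ x ^ w` continue meromorphically to `ℂ`, then the transform
`∫ ρ x ^ w (1 + u x) ^ (-s)` continues meromorphically to `ℂ²`. -/
theorem exists_isMeromorphic_mellin (hρm : Measurable ρ) (hρ : ∀ a, 0 ≤ ρ a) (hxm : Measurable x)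
    (hx : ∀ a, 0 < x a) (hu : 0 ≤ u.re) (hu1 : ‖u‖ ≤ 1)
    (hint : ∀ σ B : ℝ, 1 < σ → 0 ≤ B → Integrable (fun a => ρ a * x a ^ σ * (1 + x a) ^ B) μ)
    {M : ℂ → ℂ} (hM : ∀ w : ℂ, 1 < w.re → M w = ∫ a, ρ a * (x a : ℂ) ^ w ∂μ)
    (hMm : ∀ w, MeromorphicAt M w) :
    ∃ J : ℂ × ℂ → ℂ, IsMeromorphic J ∧ ∀ p : ℂ × ℂ, 1 < p.1.re →
      J p = ∫ a, ρ a * (x a : ℂ) ^ p.1 * (1 + u * x a) ^ (-p.2) ∂μ := by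
  choose N hN using fun p : ℂ × ℂ => exists_nat_gt (1 - p.1.re)
  have hN' : ∀ p : ℂ × ℂ, 1 < p.1.re + N p := fun p => by linarith [hN p]
  have heq : ∀ (K : ℕ) (p : ℂ × ℂ), 1 < p.1.re + K →
      mellinContinuationAux μ ρ x u M (N p) p = mellinContinuationAux μ ρ x u M K p := by
    intro K p hK
    rw [← mellinContinuationAux_eq hρm hρ hxm hx hu hu1 hint hM (le_max_left (N p) K) (hN' p),
      mellinContinuationAux_eq hρm hρ hxm hx hu hu1 hint hM (le_max_right (N p) K) hK]
  -- the order may vary with the point, since admissible orders give the same value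
  refine ⟨fun p => mellinContinuationAux μ ρ x u M (N p) p, ?_, ?_⟩
  · intro p
    have hc : Continuous (fun q : ℂ × ℂ => q.1.re) := Complex.continuous_re.comp continuous_fst
    refine IsMeromorphicNear.congr (F := mellinContinuationAux μ ρ x u M (N p)) ?_ ?_
    · refine IsMeromorphicNear.add (IsMeromorphicNear.sum _ fun k _ => ?_)
        (analyticAt_integral_mellinRemainder hρm hρ hxm hx hu hu1 hint (hN' p)).isMeromorphicNear
      refine IsMeromorphicNear.mul (AnalyticAt.isMeromorphicNear ?_) ?_
      · exact (AnalyticAt.fun_comp ((differentiable_binomCoeff k).analyticAt p.2)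
          analyticAt_snd).mul analyticAt_const
      · exact isMeromorphic_comp_affine hMm (ContinuousLinearMap.fst ℂ ℂ ℂ) k (v := (1, 0))
          (by simp) p
    · filter_upwards [hc.continuousAt.eventually
        (lt_mem_nhds (by linarith [hN' p] : 1 - N p < p.1.re))] with q hq
      exact heq (N p) q (by linarith)
  · intro p hp
    have := heq 0 p (by simpa using hp)
    dsimp only
    rw [this]
    simp only [mellinContinuationAux, Finset.range_zero, Finset.sum_empty, zero_add,
      mellinRemainder_zero]

end Mellin

/-! ### The double series `L₂` -/

/-- The positive integers carry the discrete σ-algebra. -/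
instance instMeasurableSpacePNat : MeasurableSpace ℕ+ := ⊤

theorem ofReal_cpow_eq_exp {x : ℝ} (hx : 0 < x) (w : ℂ) :
    (x : ℂ) ^ w = Complex.exp (Real.log x * w) := by
  rw [Complex.cpow_def_of_ne_zero (Complex.ofReal_ne_zero.2 hx.ne'), Complex.ofReal_log hx.le]

theorem summable_pnat_rpow_neg {σ : ℝ} (hσ : 1 < σ) : Summable fun m : ℕ+ => ((m : ℝ) ^ σ)⁻¹ :=
  (Real.summable_nat_rpow_inv.2 hσ).comp_injective PNat.coe_injective

theorem zeta_eq_tsum_pnat {w : ℂ} (hw : 1 < w.re) : riemannZeta w = ∑' m : ℕ+, 1 / (m : ℂ) ^ w := by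
  rw [zeta_eq_tsum_one_div_nat_add_one_cpow hw, tsum_pnat_eq_tsum_succ (f := fun m => 1 / (m : ℂ) ^ w)]
  simp

theorem integral_count_pnat {f : ℕ+ → ℂ} (hf : Integrable f Measure.count) :
    ∫ m, f m ∂Measure.count = ∑' m, f m := by
  rw [integral_countable hf]
  simp

theorem pnat_div_pos {n : ℕ} (hn : 1 ≤ n) (m : ℕ+) : 0 < (n : ℝ) / m :=
  div_pos (by exact_mod_cast hn) (by exact_mod_cast m.pos)

/-- The integrability condition on the transform for `x = n / m` and `ρ = 1`. -/
theorem integrable_count_div_rpow {n : ℕ} (hn : 1 ≤ n) (σ B : ℝ) (hσ : 1 < σ) (hB : 0 ≤ B) :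
    Integrable (fun m : ℕ+ => (1 : ℝ) * ((n : ℝ) / m) ^ σ * (1 + (n : ℝ) / m) ^ B)
      Measure.count := by
  rw [integrable_count_iff]
  refine Summable.of_nonneg_of_le (fun _ => norm_nonneg _) (fun m => ?_)
    ((summable_pnat_rpow_neg hσ).mul_left ((n : ℝ) ^ σ * (1 + (n : ℝ)) ^ B))
  have h1 := pnat_div_pos hn m
  have hm : (1 : ℝ) ≤ m := by exact_mod_cast one_le
  rw [Real.norm_eq_abs, abs_of_nonneg (by positivity), one_mul,
    Real.div_rpow (by positivity) (by positivity), div_eq_mul_inv, mul_right_comm]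
  gcongr
  exact div_le_self (by positivity) hm

/-- The moments of `x = n / m` for the counting measure. -/
theorem integral_count_div_cpow {n : ℕ} (hn : 1 ≤ n) {w : ℂ} (hw : 1 < w.re) :
    (n : ℂ) ^ w * riemannZeta w =
      ∫ m : ℕ+, ((1 : ℝ) : ℂ) * (((n : ℝ) / m : ℝ) : ℂ) ^ w ∂Measure.count := by
  have hn' : (0 : ℝ) < n := by exact_mod_cast hn
  rw [integral_count_pnat, zeta_eq_tsum_pnat hw, ← tsum_mul_left]
  · refine tsum_congr fun m => ?_
    have hm : (0 : ℝ) < m := by exact_mod_cast m.pos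
    have e1 : (n : ℂ) ^ w = Complex.exp (Real.log n * w) := by
      simpa using ofReal_cpow_eq_exp hn' w
    have e2 : (m : ℂ) ^ w = Complex.exp (Real.log m * w) := by
      simpa using ofReal_cpow_eq_exp hm w
    rw [e1, e2, ofReal_cpow_eq_exp (pnat_div_pos hn m), one_div, ← Complex.exp_neg,
      ← Complex.exp_add, Real.log_div hn'.ne' hm.ne', Complex.ofReal_one, one_mul]
    push_cast
    ring_nf
  · refine (integrable_count_div_rpow hn w.re 0 hw le_rfl).mono
      measurable_from_top.aestronglyMeasurable
      (Eventually.of_forall fun m => le_of_eq ?_)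
    rw [norm_mul, norm_mul, norm_mul, Complex.norm_cpow_eq_rpow_re_of_pos (pnat_div_pos hn m),
      Complex.norm_real, Real.rpow_zero, norm_one, mul_one, Real.norm_eq_abs,
      abs_of_nonneg (Real.rpow_nonneg (pnat_div_pos hn m).le _)]

/-- The point `(m, n)` of the index set of `L₂`. -/
def pairWith {n : ℕ} (hn : 1 ≤ n) (m : ℕ+) : ℕ+ × ℕ+ := (m, ⟨n, hn⟩)

theorem pairWith_injective {n : ℕ} (hn : 1 ≤ n) : Function.Injective (pairWith hn) :=
  fun _ _ h => (Prod.ext_iff.1 h).1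

theorem L2Term_pairWith {n : ℕ} (hn : 1 ≤ n) (s : ℂ × ℂ) (m : ℕ+) :
    L2Term (A0 n) s (pairWith hn m) = 1 / ((m : ℂ) ^ s.1 * ((m : ℂ) + (n : ℂ)) ^ s.2) := by
  simp [L2Term, A0, pairWith]

theorem L2Term_eq_zero {n : ℕ} (hn : 1 ≤ n) (s : ℂ × ℂ) (p : ℕ+ × ℕ+)
    (hp : p ∉ Set.range (pairWith hn)) : L2Term (A0 n) s p = 0 := by
  have : (p.2 : ℕ) ≠ n := fun h => hp ⟨p.1, Prod.ext rfl (PNat.eq h.symm)⟩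
  simp [L2Term, A0, this]

theorem L2_term_eq {n : ℕ} (hn : 1 ≤ n) (s : ℂ × ℂ) (m : ℕ+) :
    1 / ((m : ℂ) ^ s.1 * ((m : ℂ) + (n : ℂ)) ^ s.2) = (n : ℂ) ^ (-(s.1 + s.2)) *
      (((1 : ℝ) : ℂ) * (((n : ℝ) / m : ℝ) : ℂ) ^ (s.1 + s.2) *
        (1 + 1 * (((n : ℝ) / m : ℝ) : ℂ)) ^ (-s.2)) := by
  have hn' : (0 : ℝ) < n := by exact_mod_cast hn
  have hm : (0 : ℝ) < m := by exact_mod_cast m.pos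
  have e1 : (n : ℂ) ^ (-(s.1 + s.2)) = Complex.exp (Real.log n * (-(s.1 + s.2))) := by
    simpa using ofReal_cpow_eq_exp hn' (-(s.1 + s.2))
  have e2 : (m : ℂ) ^ s.1 = Complex.exp (Real.log m * s.1) := by
    simpa using ofReal_cpow_eq_exp hm s.1
  have e3 : ((m : ℂ) + n) ^ s.2 = Complex.exp (Real.log (m + n) * s.2) := by
    simpa using ofReal_cpow_eq_exp (add_pos hm hn') s.2
  have e4 : (1 + 1 * (((n : ℝ) / m : ℝ) : ℂ)) ^ (-s.2) =
      Complex.exp ((Real.log (m + n) - Real.log m) * (-s.2)) := by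
    have := ofReal_cpow_eq_exp (div_pos (add_pos hm hn') hm) (-s.2)
    rw [Real.log_div (add_pos hm hn').ne' hm.ne', add_div, div_self hm.ne'] at this
    rw [one_mul]
    push_cast at this ⊢
    exact this
  rw [e1, e2, e3, e4, ofReal_cpow_eq_exp (pnat_div_pos hn m), Real.log_div hn'.ne' hm.ne',
    Complex.ofReal_one, one_mul, ← Complex.exp_add, ← Complex.exp_add, ← Complex.exp_add, one_div,
    ← Complex.exp_neg]
  push_cast
  ring_nf

theorem integrable_count_mellin {n : ℕ} (hn : 1 ≤ n) {s : ℂ × ℂ} (hs : s ∈ regionL) :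
    Integrable (fun m : ℕ+ => ((1 : ℝ) : ℂ) * (((n : ℝ) / m : ℝ) : ℂ) ^ (s.1 + s.2) *
        (1 + 1 * (((n : ℝ) / m : ℝ) : ℂ)) ^ (-s.2)) Measure.count := by
  have h := integrable_mellinRemainder (α := ℕ+) (μ := Measure.count) (ρ := fun _ => 1)
    (x := fun m => (n : ℝ) / m) (u := 1) (K := 0) (p := (s.1 + s.2, s.2)) (by fun_prop)
    (fun _ => zero_le_one) (by fun_prop) (pnat_div_pos hn) (by simp) (by simp)
    (integrable_count_div_rpow hn) (by simpa [regionL] using hs)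
  exact h.congr (Eventually.of_forall fun m => mellinRemainder_zero _ _)

theorem summable_L2_row {n : ℕ} (hn : 1 ≤ n) {s : ℂ × ℂ} (hs : s ∈ regionL) :
    Summable fun m : ℕ+ => 1 / ((m : ℂ) ^ s.1 * ((m : ℂ) + (n : ℂ)) ^ s.2) := by
  simp only [L2_term_eq hn]
  exact ((integrable_count_iff.1 (integrable_count_mellin hn hs)).of_norm).mul_left _

theorem summable_L2Term {n : ℕ} (hn : 1 ≤ n) {s : ℂ × ℂ} (hs : s ∈ regionL) :
    Summable (L2Term (A0 n) s) := by
  rw [← (pairWith_injective hn).summable_iff (L2Term_eq_zero hn s)]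
  exact (summable_L2_row hn hs).congr fun m => (L2Term_pairWith hn s m).symm

theorem hasSum_L2_row {n : ℕ} (hn : 1 ≤ n) {s : ℂ × ℂ} (hs : s ∈ regionL) :
    HasSum (fun m : ℕ+ => 1 / ((m : ℂ) ^ s.1 * ((m : ℂ) + (n : ℂ)) ^ s.2))
      (L2Series (A0 n) s) := by
  have h := (summable_L2Term hn hs).hasSum
  rw [← (pairWith_injective hn).hasSum_iff (L2Term_eq_zero hn s)] at h
  have e : L2Term (A0 n) s ∘ pairWith hn = _ := funext (L2Term_pairWith hn s)
  rwa [e] at h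

theorem L2Series_eq_integral {n : ℕ} (hn : 1 ≤ n) {s : ℂ × ℂ} (hs : s ∈ regionL) :
    L2Series (A0 n) s = (n : ℂ) ^ (-(s.1 + s.2)) * ∫ m : ℕ+, ((1 : ℝ) : ℂ) *
      (((n : ℝ) / m : ℝ) : ℂ) ^ (s.1 + s.2) * (1 + 1 * (((n : ℝ) / m : ℝ) : ℂ)) ^ (-s.2)
        ∂Measure.count := by
  rw [integral_count_pnat (integrable_count_mellin hn hs), ← tsum_mul_left,
    ← (hasSum_L2_row hn hs).tsum_eq]
  exact tsum_congr (L2_term_eq hn s)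

theorem natCast_cpow_analyticAt {n : ℕ} (hn : 1 ≤ n) {f : ℂ × ℂ → ℂ} {p : ℂ × ℂ}
    (hf : AnalyticAt ℂ f p) : AnalyticAt ℂ (fun q => (n : ℂ) ^ f q) p := by
  have hn0 : (n : ℂ) ≠ 0 := by exact_mod_cast (by omega : n ≠ 0)
  have : (fun q => (n : ℂ) ^ f q) = fun q => Complex.exp (Complex.log n * f q) := by
    ext q; rw [Complex.cpow_def_of_ne_zero hn0]
  rw [this]
  exact (analyticAt_const.mul hf).cexp

/-- The shear `(s₁, s₂) ↦ (s₁ + s₂, s₂)` of `ℂ²`. -/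
def shear : ℂ × ℂ ≃ₜ ℂ × ℂ where
  toFun s := (s.1 + s.2, s.2)
  invFun s := (s.1 - s.2, s.2)
  left_inv s := by simp
  right_inv s := by simp
  continuous_toFun := by fun_prop
  continuous_invFun := by fun_prop

theorem exists_continuation_L2 {n : ℕ} (hn : 1 ≤ n) :
    ∃ L : ℂ × ℂ → ℂ, IsMeromorphicContinuation (L2Series (A0 n)) regionL L := by
  obtain ⟨J, hJ, hJe⟩ := exists_isMeromorphic_mellin (α := ℕ+) (μ := Measure.count)
    (ρ := fun _ => 1) (x := fun m => (n : ℝ) / m) (u := 1)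
    (M := fun w => (n : ℂ) ^ w * riemannZeta w) (by fun_prop)
    (fun _ => zero_le_one) (by fun_prop) (pnat_div_pos hn) (by simp) (by simp)
    (integrable_count_div_rpow hn) (fun w hw => integral_count_div_cpow hn hw) (fun w => by
      have hn0 : (n : ℂ) ≠ 0 := by exact_mod_cast (by omega : n ≠ 0)
      have : Differentiable ℂ (fun w : ℂ => (n : ℂ) ^ w) :=
        differentiable_id.const_cpow (Or.inl hn0)
      exact (this.analyticAt w).meromorphicAt.mul (meromorphicAt_riemannZeta w))
  refine ⟨fun s => (n : ℂ) ^ (-(s.1 + s.2)) * J (shear s), ?_, ?_⟩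
  · intro p
    refine IsMeromorphicNear.mul (AnalyticAt.isMeromorphicNear ?_)
      (hJ.comp_homeomorph shear (fun p => ?_) p)
    · exact natCast_cpow_analyticAt hn (analyticAt_fst.add analyticAt_snd).neg
    · exact (analyticAt_fst.add analyticAt_snd).prod analyticAt_snd
  · intro s hs
    rw [L2Series_eq_integral hn hs, ← hJe (s.1 + s.2, s.2) hs]
    rfl

/-! ### The confluent hypergeometric integral in logarithmic coordinates -/

theorem image_mul_exp {c : ℝ} (hc : 0 < c) :
    (fun v => c * Real.exp v) '' Set.univ = Set.Ioi (0 : ℝ) := by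
  ext t
  simp only [Set.image_univ, Set.mem_range, Set.mem_Ioi]
  constructor
  · rintro ⟨v, rfl⟩
    positivity
  · intro ht
    exact ⟨Real.log (t / c), by rw [Real.exp_log (by positivity)]; field_simp⟩

theorem injOn_mul_exp {c : ℝ} (hc : 0 < c) :
    Set.InjOn (fun v => c * Real.exp v) Set.univ := fun _ _ _ _ h =>
  Real.exp_injective (mul_left_cancel₀ hc.ne' h)

theorem integral_Ioi_eq_integral_exp (g : ℝ → ℂ) {c : ℝ} (hc : 0 < c) :
    ∫ t in Set.Ioi (0 : ℝ), g t =
      ∫ v, ((c * Real.exp v : ℝ) : ℂ) * g (c * Real.exp v) := by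
  rw [← image_mul_exp hc, integral_image_eq_integral_abs_deriv_smul MeasurableSet.univ
    (f' := fun v => c * Real.exp v)
    (fun v _ => ((Real.hasDerivAt_exp v).const_mul c).hasDerivWithinAt) (injOn_mul_exp hc)]
  rw [Measure.restrict_univ]
  refine integral_congr_ae (Eventually.of_forall fun v => ?_)
  dsimp only
  rw [abs_of_pos (by positivity), Complex.real_smul]

theorem integrableOn_Ioi_iff_integrable_exp (g : ℝ → ℂ) {c : ℝ} (hc : 0 < c) :
    IntegrableOn g (Set.Ioi (0 : ℝ)) ↔
      Integrable fun v => ((c * Real.exp v : ℝ) : ℂ) * g (c * Real.exp v) := by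
  rw [← image_mul_exp hc, integrableOn_image_iff_integrableOn_abs_deriv_smul MeasurableSet.univ
    (f' := fun v => c * Real.exp v)
    (fun v _ => ((Real.hasDerivAt_exp v).const_mul c).hasDerivWithinAt) (injOn_mul_exp hc),
    integrableOn_univ]
  refine integrable_congr (Eventually.of_forall fun v => ?_)
  dsimp only
  rw [abs_of_pos (by positivity), Complex.real_smul]

theorem ofReal_cpow_sub_one_mul {x : ℝ} (hx : 0 < x) (w : ℂ) :
    (x : ℂ) * (x : ℂ) ^ (w - 1) = (x : ℂ) ^ w := by
  have hx' : (x : ℂ) ≠ 0 := Complex.ofReal_ne_zero.2 hx.ne'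
  rw [Complex.cpow_sub _ _ hx', Complex.cpow_one]
  field_simp

theorem integrable_exp_neg_exp_cpow {w : ℂ} (hw : 0 < w.re) :
    Integrable fun v : ℝ => (Real.exp (-Real.exp v) : ℂ) * (Real.exp v : ℂ) ^ w := by
  have h := (integrableOn_Ioi_iff_integrable_exp _ one_pos).1 (Complex.GammaIntegral_convergent hw)
  refine h.congr (Eventually.of_forall fun v => ?_)
  dsimp only
  rw [one_mul, ← ofReal_cpow_sub_one_mul (Real.exp_pos v) w]
  ring

theorem integral_exp_neg_exp_cpow {w : ℂ} (hw : 0 < w.re) :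
    ∫ v : ℝ, (Real.exp (-Real.exp v) : ℂ) * (Real.exp v : ℂ) ^ w = Complex.Gamma w := by
  rw [Complex.Gamma_eq_integral hw, Complex.GammaIntegral, integral_Ioi_eq_integral_exp _ one_pos]
  refine integral_congr_ae (Eventually.of_forall fun v => ?_)
  dsimp only
  rw [one_mul, ← ofReal_cpow_sub_one_mul (Real.exp_pos v) w]
  ring

theorem integrable_exp_neg_exp_rpow {σ B : ℝ} (hσ : 0 < σ) (hB : 0 ≤ B) :
    Integrable fun v : ℝ => Real.exp (-Real.exp v) * Real.exp v ^ σ * (1 + Real.exp v) ^ B := by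
  have key : ∀ σ : ℝ, 0 < σ → Integrable fun v : ℝ => Real.exp (-Real.exp v) * Real.exp v ^ σ := by
    intro σ hσ
    have h := (integrable_exp_neg_exp_cpow (w := σ) (by simpa using hσ)).norm
    refine h.congr (Eventually.of_forall fun v => ?_)
    dsimp only
    rw [norm_mul, Complex.norm_cpow_eq_rpow_re_of_pos (Real.exp_pos v), Complex.norm_real,
      Real.norm_eq_abs, abs_of_pos (Real.exp_pos _), Complex.ofReal_re]
  refine (((key σ hσ).add (key (σ + B) (by linarith))).const_mul (2 ^ B)).mono'
    (Measurable.aestronglyMeasurable (by fun_prop)) (Eventually.of_forall fun v => ?_)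
  have hpos := Real.exp_pos v
  have hle : (1 + Real.exp v) ^ B ≤ 2 ^ B * (1 + Real.exp v ^ B) := by
    have h2 : (0 : ℝ) ≤ 2 ^ B := by positivity
    have h3 : 0 ≤ Real.exp v ^ B := by positivity
    rcases le_total (Real.exp v) 1 with h | h
    · calc (1 + Real.exp v) ^ B ≤ 2 ^ B :=
            Real.rpow_le_rpow (by positivity) (by linarith) hB
        _ ≤ _ := by nlinarith
    · calc (1 + Real.exp v) ^ B ≤ (2 * Real.exp v) ^ B :=
            Real.rpow_le_rpow (by positivity) (by linarith) hB
        _ = 2 ^ B * Real.exp v ^ B := Real.mul_rpow (by positivity) hpos.le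
        _ ≤ _ := by nlinarith
  rw [Real.norm_eq_abs, abs_of_nonneg (by positivity)]
  calc _ ≤ Real.exp (-Real.exp v) * Real.exp v ^ σ * (2 ^ B * (1 + Real.exp v ^ B)) := by gcongr
    _ = _ := by
      simp only [Pi.add_apply]
      rw [Real.rpow_add hpos]
      ring

/-- The direction of the ray of integration in `Ψ(a, b; 2π i ε l)`. -/
theorem exp_neg_arg_psiPoint {ε : ℂ} (hε : ε = 1 ∨ ε = -1) {l : ℕ} (hl : 1 ≤ l) :
    Complex.exp (-(Complex.arg (psiPoint ε l) : ℂ) * Complex.I) = -ε * Complex.I := by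
  have hpos : (0 : ℝ) < 2 * Real.pi * l := by
    have : (0 : ℝ) < l := by exact_mod_cast hl
    positivity
  rcases hε with rfl | rfl
  · have : psiPoint 1 l = ((2 * Real.pi * l : ℝ) : ℂ) * Complex.I := by
      rw [psiPoint]; push_cast; ring
    rw [this, Complex.arg_real_mul _ hpos, Complex.arg_I]
    push_cast
    rw [show -((Real.pi : ℂ) / 2) * Complex.I = -(Real.pi / 2 * Complex.I) by ring,
      Complex.exp_neg, Complex.exp_pi_div_two_mul_I, Complex.inv_I]
    ring
  · have : psiPoint (-1) l = ((2 * Real.pi * l : ℝ) : ℂ) * -Complex.I := by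
      rw [psiPoint]; push_cast; ring
    rw [this, Complex.arg_real_mul _ hpos, Complex.arg_neg_I]
    push_cast
    rw [show -(-((Real.pi : ℂ) / 2)) * Complex.I = Real.pi / 2 * Complex.I by ring,
      Complex.exp_pi_div_two_mul_I]
    ring

theorem sign_sq {ε : ℂ} (hε : ε = 1 ∨ ε = -1) : ε * ε = 1 := by
  rcases hε with rfl | rfl <;> norm_num

theorem neg_sign_mul_I_ne_zero {ε : ℂ} (hε : ε = 1 ∨ ε = -1) : -ε * Complex.I ≠ 0 := by
  rcases hε with rfl | rfl <;> simp

theorem neg_sign_mul_I_re {ε : ℂ} (hε : ε = 1 ∨ ε = -1) : 0 ≤ (-ε * Complex.I).re := by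
  rcases hε with rfl | rfl <;> simp

theorem norm_neg_sign_mul_I {ε : ℂ} (hε : ε = 1 ∨ ε = -1) : ‖-ε * Complex.I‖ ≤ 1 := by
  rcases hε with rfl | rfl <;> simp

theorem psiIntegrand_eq {ε : ℂ} (hε : ε = 1 ∨ ε = -1) (s : ℂ × ℂ) {l : ℕ} (hl : 1 ≤ l) {t : ℝ}
    (ht : 0 < t) : psiIntegrand s.2 (s.1 + s.2) (psiPoint ε l) t =
      (-ε * Complex.I) ^ s.2 * (Real.exp (-(2 * Real.pi * l * t)) * (t : ℂ) ^ (s.2 - 1) *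
        (1 + -ε * Complex.I * t) ^ (-(1 - s.1))) := by
  have hu := neg_sign_mul_I_ne_zero hε
  rw [psiIntegrand]
  simp only [exp_neg_arg_psiPoint hε hl]
  set u := -ε * Complex.I with hu_def
  have ht' : (t : ℂ) ≠ 0 := Complex.ofReal_ne_zero.2 ht.ne'
  have e1 : -psiPoint ε l * (u * t) = ((-(2 * Real.pi * l * t) : ℝ) : ℂ) := by
    rw [psiPoint, hu_def]
    push_cast
    linear_combination (2 * Real.pi * l * t * Complex.I * Complex.I) * sign_sq hε +
      (2 * Real.pi * l * t) * Complex.I_mul_I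
  have e2 : (u * t) ^ (s.2 - 1) * u = u ^ s.2 * (t : ℂ) ^ (s.2 - 1) := by
    rw [mul_comm u (t : ℂ), Complex.cpow_def_of_ne_zero (mul_ne_zero ht' hu),
      Complex.log_ofReal_mul ht hu, Complex.cpow_def_of_ne_zero hu, ofReal_cpow_eq_exp ht]
    nth_rewrite 2 [← Complex.exp_log hu]
    rw [← Complex.exp_add, ← Complex.exp_add]
    ring_nf
  rw [e1, Complex.ofReal_exp, show s.1 + s.2 - s.2 - 1 = -(1 - s.1) by ring, add_comm (u * t) 1]
  linear_combination (Complex.exp ((-(2 * Real.pi * l * t) : ℝ) : ℂ) *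
    (1 + u * t) ^ (-(1 - s.1))) * e2

theorem two_pi_mul_pos {l : ℕ} (hl : 1 ≤ l) : 0 < 2 * Real.pi * l := by
  have : (0 : ℝ) < l := by exact_mod_cast hl
  positivity

theorem one_le_two_pi_mul {l : ℕ} (hl : 1 ≤ l) : 1 ≤ 2 * Real.pi * l := by
  have : (1 : ℝ) ≤ l := by exact_mod_cast hl
  nlinarith [Real.pi_gt_three]

/-- The integrand of `Ψ(s₂, s₁ + s₂; 2π i ε l)` under the substitution `t = e ^ v / (2π l)`. -/
theorem psiIntegrand_exp {ε : ℂ} (hε : ε = 1 ∨ ε = -1) (s : ℂ × ℂ) {l : ℕ} (hl : 1 ≤ l) (v : ℝ) :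
    (((2 * Real.pi * l)⁻¹ * Real.exp v : ℝ) : ℂ) *
      psiIntegrand s.2 (s.1 + s.2) (psiPoint ε l) ((2 * Real.pi * l)⁻¹ * Real.exp v) =
      (-ε * Complex.I) ^ s.2 * (Real.exp (-Real.exp v) *
        ((Real.exp v / (2 * Real.pi * l) : ℝ) : ℂ) ^ s.2 *
        (1 + -ε * Complex.I * ((Real.exp v / (2 * Real.pi * l) : ℝ) : ℂ)) ^ (-(1 - s.1))) := by
  have hl' := two_pi_mul_pos hl
  have hx : 0 < Real.exp v / (2 * Real.pi * l) := by positivity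
  rw [inv_mul_eq_div, psiIntegrand_eq hε s hl hx, ← ofReal_cpow_sub_one_mul hx s.2,
    mul_div_cancel₀ _ hl'.ne']
  ring

theorem integrable_exp_div_rpow {σ B : ℝ} (hσ : 0 < σ) (hB : 0 ≤ B) {l : ℕ} (hl : 1 ≤ l) :
    Integrable fun v : ℝ => Real.exp (-Real.exp v) * (Real.exp v / (2 * Real.pi * l)) ^ σ *
      (1 + Real.exp v / (2 * Real.pi * l)) ^ B := by
  have hl' := two_pi_mul_pos hl
  refine ((integrable_exp_neg_exp_rpow hσ hB)).mono'
    (Measurable.aestronglyMeasurable (by fun_prop)) (Eventually.of_forall fun v => ?_)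
  have hle : Real.exp v / (2 * Real.pi * l) ≤ Real.exp v :=
    div_le_self (Real.exp_pos v).le (one_le_two_pi_mul hl)
  rw [Real.norm_eq_abs, abs_of_nonneg (by positivity)]
  gcongr

theorem integrableOn_psiIntegrand {ε : ℂ} (hε : ε = 1 ∨ ε = -1) {s : ℂ × ℂ} (hs : 0 < s.2.re)
    {l : ℕ} (hl : 1 ≤ l) :
    IntegrableOn (psiIntegrand s.2 (s.1 + s.2) (psiPoint ε l)) (Set.Ioi (0 : ℝ)) := by
  have hl' := two_pi_mul_pos hl
  rw [integrableOn_Ioi_iff_integrable_exp _ (inv_pos.2 hl')]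
  simp only [psiIntegrand_exp hε s hl]
  refine Integrable.const_mul ?_ _
  obtain ⟨C, B, hB, h⟩ := exists_norm_mellinRemainder_le (ρ := fun v : ℝ => Real.exp (-Real.exp v))
    (x := fun v => Real.exp v / (2 * Real.pi * l)) (fun v => (Real.exp_pos _).le)
    (fun v => by positivity) (neg_sign_mul_I_re hε) (norm_neg_sign_mul_I hε) 0
    (norm_nonneg (1 - s.1)) (le_refl s.2.re)
  refine ((integrable_exp_div_rpow (by simpa using hs) hB hl).const_mul C).mono'
    (Measurable.aestronglyMeasurable (by fun_prop)) (Eventually.of_forall fun v => ?_)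
  have := h (s.2, 1 - s.1) le_rfl le_rfl le_rfl v
  rwa [mellinRemainder_zero, Nat.cast_zero, add_zero] at this

theorem Psi_eq_integral {ε : ℂ} (hε : ε = 1 ∨ ε = -1) (s : ℂ × ℂ) {l : ℕ} (hl : 1 ≤ l) :
    Psi s.2 (s.1 + s.2) (psiPoint ε l) = (Complex.Gamma s.2)⁻¹ * ((-ε * Complex.I) ^ s.2 *
      ∫ v : ℝ, Real.exp (-Real.exp v) * ((Real.exp v / (2 * Real.pi * l) : ℝ) : ℂ) ^ s.2 *
        (1 + -ε * Complex.I * ((Real.exp v / (2 * Real.pi * l) : ℝ) : ℂ)) ^ (-(1 - s.1))) := by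
  rw [Psi, one_div, integral_Ioi_eq_integral_exp _ (inv_pos.2 (two_pi_mul_pos hl))]
  simp only [psiIntegrand_exp hε s hl]
  rw [integral_const_mul]

/-! ### The series `F_±` -/

/-- The variable `e ^ v / (2π k n)` on the space of pairs `(k, v)`. -/
def psiVar (n : ℕ) (a : ℕ+ × ℝ) : ℝ := Real.exp a.2 / (2 * Real.pi * ((a.1 : ℕ) * n : ℕ))

/-- The weight `exp (-e ^ v)` on the space of pairs `(k, v)`. -/
def psiWeight (a : ℕ+ × ℝ) : ℝ := Real.exp (-Real.exp a.2)

/-- The product of the counting measure on the positive integers and Lebesgue measure. -/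
def psiMeasure : Measure (ℕ+ × ℝ) := Measure.count.prod volume

theorem one_le_pnat_mul {n : ℕ} (hn : 1 ≤ n) (k : ℕ+) : 1 ≤ (k : ℕ) * n :=
  Nat.mul_pos k.pos hn

theorem psiVar_pos {n : ℕ} (hn : 1 ≤ n) (a : ℕ+ × ℝ) : 0 < psiVar n a :=
  div_pos (Real.exp_pos _) (two_pi_mul_pos (one_le_pnat_mul hn a.1))

theorem measurable_psiVar (n : ℕ) : Measurable (psiVar n) := by
  unfold psiVar
  have h : Measurable fun k : ℕ+ => (2 * Real.pi * ((k : ℕ) * n : ℕ) : ℝ) := measurable_from_top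
  exact (Real.measurable_exp.comp measurable_snd).div (h.comp measurable_fst)

theorem measurable_psiWeight : Measurable psiWeight := by
  unfold psiWeight
  fun_prop

theorem psiVar_eq {n : ℕ} (a : ℕ+ × ℝ) :
    psiVar n a = (2 * Real.pi * n)⁻¹ * ((a.1 : ℝ)⁻¹ * Real.exp a.2) := by
  rw [psiVar]
  push_cast
  field_simp

/-- The integrability condition on the transform for the pairs `(k, v)`. -/
theorem integrable_psiVar_rpow {n : ℕ} (hn : 1 ≤ n) (σ B : ℝ) (hσ : 1 < σ) (hB : 0 ≤ B) :
    Integrable (fun a => psiWeight a * psiVar n a ^ σ * (1 + psiVar n a) ^ B) psiMeasure := by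
  have hc : Integrable (fun k : ℕ+ => ((k : ℝ) ^ σ)⁻¹) Measure.count :=
    integrable_count_iff.2 (summable_pnat_rpow_neg hσ).norm
  have h := hc.mul_prod (integrable_exp_neg_exp_rpow (by linarith : 0 < σ) hB)
  refine (h.const_mul (((2 * Real.pi * n)⁻¹) ^ σ)).mono' ?_ (Eventually.of_forall fun a => ?_)
  · have := measurable_psiVar n
    have := measurable_psiWeight
    exact Measurable.aestronglyMeasurable (by fun_prop)
  · have hp := psiVar_pos hn a
    have hle : psiVar n a ≤ Real.exp a.2 :=
      div_le_self (Real.exp_pos _).le (one_le_two_pi_mul (one_le_pnat_mul hn a.1))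
    have hw : 0 ≤ psiWeight a := (Real.exp_pos _).le
    have hk : (0 : ℝ) < a.1 := by exact_mod_cast a.1.pos
    have hn' := two_pi_mul_pos hn
    rw [Real.norm_eq_abs, abs_of_nonneg (by positivity)]
    calc psiWeight a * psiVar n a ^ σ * (1 + psiVar n a) ^ B
        ≤ psiWeight a * psiVar n a ^ σ * (1 + Real.exp a.2) ^ B := by gcongr
      _ = _ := by
        rw [psiVar_eq, Real.mul_rpow (by positivity) (by positivity),
          Real.mul_rpow (by positivity) (by positivity), Real.inv_rpow hk.le, psiWeight]
        ring

theorem psiVar_cpow {n : ℕ} (hn : 1 ≤ n) (a : ℕ+ × ℝ) (w : ℂ) :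
    (psiVar n a : ℂ) ^ w =
      ((2 * Real.pi * n : ℝ) : ℂ) ^ (-w) * (1 / (a.1 : ℂ) ^ w * (Real.exp a.2 : ℂ) ^ w) := by
  have hk : (0 : ℝ) < a.1 := by exact_mod_cast a.1.pos
  have hn' := two_pi_mul_pos hn
  have e : (a.1 : ℂ) ^ w = Complex.exp (Real.log a.1 * w) := by
    simpa using ofReal_cpow_eq_exp hk w
  rw [ofReal_cpow_eq_exp (psiVar_pos hn a), psiVar_eq, Real.log_mul (by positivity) (by positivity),
    Real.log_mul (by positivity) (by positivity), Real.log_inv, Real.log_inv, e,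
    ofReal_cpow_eq_exp hn', ofReal_cpow_eq_exp (Real.exp_pos _), one_div, ← Complex.exp_neg,
    ← Complex.exp_add, ← Complex.exp_add]
  push_cast
  ring_nf

/-- The moments of `x = e ^ v / (2π k n)` for the weight `exp (-e ^ v)`. -/
theorem integral_psiVar_cpow {n : ℕ} (hn : 1 ≤ n) {w : ℂ} (hw : 1 < w.re) :
    ((2 * Real.pi * n : ℝ) : ℂ) ^ (-w) * (riemannZeta w * Complex.Gamma w) =
      ∫ a, (psiWeight a : ℂ) * (psiVar n a : ℂ) ^ w ∂psiMeasure := by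
  have hc : Integrable (fun k : ℕ+ => 1 / (k : ℂ) ^ w) Measure.count := by
    refine integrable_count_iff.2 ((summable_pnat_rpow_neg hw).congr fun k => ?_)
    have := Complex.norm_cpow_eq_rpow_re_of_pos (by exact_mod_cast k.pos : (0 : ℝ) < k) w
    rw [Complex.ofReal_natCast] at this
    rw [norm_div, norm_one, this, one_div]
  rw [zeta_eq_tsum_pnat hw, ← integral_count_pnat hc,
    ← integral_exp_neg_exp_cpow (by linarith : 0 < w.re), psiMeasure, ← integral_prod_mul,
    ← integral_const_mul]
  refine integral_congr_ae (Eventually.of_forall fun a => ?_)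
  simp only [psiVar_cpow hn, psiWeight]
  ring

/-- The integrand whose integral over all pairs `(k, v)` is, up to elementary factors, the sum over
`k` of `Ψ(s₂, s₁ + s₂; 2π i ε k n)`. -/
def psiKernel (n : ℕ) (ε : ℂ) (s : ℂ × ℂ) (a : ℕ+ × ℝ) : ℂ :=
  psiWeight a * (psiVar n a : ℂ) ^ s.2 * (1 + -ε * Complex.I * psiVar n a) ^ (-(1 - s.1))

theorem integrable_psiKernel {n : ℕ} (hn : 1 ≤ n) {ε : ℂ} (hε : ε = 1 ∨ ε = -1) {s : ℂ × ℂ}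
    (hs : s ∈ regionF) : Integrable (psiKernel n ε s) psiMeasure := by
  have h := integrable_mellinRemainder (μ := psiMeasure) (ρ := psiWeight) (x := psiVar n)
    (u := -ε * Complex.I) (K := 0) (p := (s.2, 1 - s.1)) measurable_psiWeight
    (fun _ => (Real.exp_pos _).le) (measurable_psiVar n) (psiVar_pos hn) (neg_sign_mul_I_re hε)
    (norm_neg_sign_mul_I hε) (integrable_psiVar_rpow hn) (by simpa [regionF] using hs)
  exact h.congr (Eventually.of_forall fun a => mellinRemainder_zero _ _)

theorem Psi_eq_integral_psiKernel {n : ℕ} (hn : 1 ≤ n) {ε : ℂ} (hε : ε = 1 ∨ ε = -1) (s : ℂ × ℂ)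
    (k : ℕ+) : Psi s.2 (s.1 + s.2) (psiPoint ε ((k : ℕ) * n)) =
      (Complex.Gamma s.2)⁻¹ * ((-ε * Complex.I) ^ s.2 * ∫ v : ℝ, psiKernel n ε s (k, v)) :=
  Psi_eq_integral hε s (one_le_pnat_mul hn k)

theorem hasSum_Psi {n : ℕ} (hn : 1 ≤ n) {ε : ℂ} (hε : ε = 1 ∨ ε = -1) {s : ℂ × ℂ}
    (hs : s ∈ regionF) :
    HasSum (fun k : ℕ+ => Psi s.2 (s.1 + s.2) (psiPoint ε ((k : ℕ) * n)))
      ((Complex.Gamma s.2)⁻¹ * ((-ε * Complex.I) ^ s.2 * ∫ a, psiKernel n ε s a ∂psiMeasure)) := by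
  have hi := integrable_psiKernel hn hε hs
  have h1 := Integrable.integral_prod_left hi
  have h2 := (integrable_count_iff.1 h1).of_norm.hasSum
  rw [← integral_count_pnat h1, ← integral_prod _ hi] at h2
  simp only [Psi_eq_integral_psiKernel hn hε s]
  exact (h2.mul_left _).mul_left _

theorem divisorCoeff_A0 {n : ℕ} (c : ℂ) {l : ℕ} (hl : l ≠ 0) :
    divisorCoeff (A0 n) c l = if n ∣ l then (n : ℂ) ^ c else 0 := by
  simp [divisorCoeff, A0, Finset.sum_ite_eq', hl]

/-- Multiplication by `n` on the positive integers. -/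
def mulBy {n : ℕ} (hn : 1 ≤ n) (k : ℕ+) : ℕ+ := k * ⟨n, hn⟩

theorem mulBy_injective {n : ℕ} (hn : 1 ≤ n) : Function.Injective (mulBy hn) :=
  fun _ _ h => mul_right_cancel h

theorem FTerm_mulBy {n : ℕ} (hn : 1 ≤ n) (ε : ℂ) (s : ℂ × ℂ) (k : ℕ+) :
    FTerm (A0 n) ε s (mulBy hn k) = (n : ℂ) ^ (s.1 + s.2 - 1) *
      Psi s.2 (s.1 + s.2) (psiPoint ε ((k : ℕ) * n)) := by
  have h : ((mulBy hn k : ℕ+) : ℕ) = k * n := rfl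
  rw [FTerm, divisorCoeff_A0 _ (mulBy hn k).ne_zero, h, if_pos (dvd_mul_left _ _)]

theorem FTerm_eq_zero {n : ℕ} (hn : 1 ≤ n) (ε : ℂ) (s : ℂ × ℂ) (l : ℕ+)
    (hl : l ∉ Set.range (mulBy hn)) : FTerm (A0 n) ε s l = 0 := by
  have : ¬ n ∣ l := by
    rintro ⟨k, hk⟩
    have hk0 : 0 < k := Nat.pos_of_ne_zero fun h => l.ne_zero (by rw [hk, h, mul_zero])
    exact hl ⟨⟨k, hk0⟩, PNat.eq (by rw [hk, mul_comm]; rfl)⟩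
  rw [FTerm, divisorCoeff_A0 _ l.ne_zero, if_neg this, zero_mul]

theorem hasSum_FTerm {n : ℕ} (hn : 1 ≤ n) {ε : ℂ} (hε : ε = 1 ∨ ε = -1) {s : ℂ × ℂ}
    (hs : s ∈ regionF) : HasSum (FTerm (A0 n) ε s) ((n : ℂ) ^ (s.1 + s.2 - 1) *
      ∑' k : ℕ+, Psi s.2 (s.1 + s.2) (psiPoint ε ((k : ℕ) * n))) := by
  rw [← (mulBy_injective hn).hasSum_iff (FTerm_eq_zero hn ε s)]
  have e : FTerm (A0 n) ε s ∘ mulBy hn = _ := funext (FTerm_mulBy hn ε s)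
  rw [e]
  exact (hasSum_Psi hn hε hs).summable.hasSum.mul_left _

/-- The change of coordinates `(s₁, s₂) ↦ (s₂, 1 - s₁)` of `ℂ²`. -/
def quarterTurn : ℂ × ℂ ≃ₜ ℂ × ℂ where
  toFun s := (s.2, 1 - s.1)
  invFun s := (1 - s.2, s.1)
  left_inv s := by simp
  right_inv s := by simp
  continuous_toFun := by fun_prop
  continuous_invFun := by fun_prop

theorem analyticAt_inv_Gamma (z : ℂ) : AnalyticAt ℂ (fun s => (Complex.Gamma s)⁻¹) z :=
  Complex.differentiable_one_div_Gamma.analyticAt z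

theorem exists_continuation_F {n : ℕ} (hn : 1 ≤ n) {ε : ℂ} (hε : ε = 1 ∨ ε = -1) :
    ∃ F : ℂ × ℂ → ℂ, IsMeromorphicContinuation (FSeries (A0 n) ε) regionF F := by
  have hpi : ((2 * Real.pi * n : ℝ) : ℂ) ≠ 0 :=
    Complex.ofReal_ne_zero.2 (two_pi_mul_pos hn).ne'
  obtain ⟨J, hJ, hJe⟩ := exists_isMeromorphic_mellin (μ := psiMeasure) (ρ := psiWeight)
    (x := psiVar n) (u := -ε * Complex.I) measurable_psiWeight
    (fun _ => (Real.exp_pos _).le) (measurable_psiVar n) (psiVar_pos hn) (neg_sign_mul_I_re hε)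
    (norm_neg_sign_mul_I hε) (integrable_psiVar_rpow hn)
    (fun w hw => integral_psiVar_cpow hn hw) (fun w => by
      have : Differentiable ℂ (fun w : ℂ => ((2 * Real.pi * n : ℝ) : ℂ) ^ (-w)) :=
        differentiable_id.neg.const_cpow (Or.inl hpi)
      exact (this.analyticAt w).meromorphicAt.mul
        ((meromorphicAt_riemannZeta w).mul (meromorphicAt_Gamma w)))
  refine ⟨fun s => (n : ℂ) ^ (s.1 + s.2 - 1) * ((Complex.Gamma s.2)⁻¹ *
    ((-ε * Complex.I) ^ s.2)) * J (quarterTurn s), ?_, ?_⟩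
  · intro p
    refine IsMeromorphicNear.mul (AnalyticAt.isMeromorphicNear ?_)
      (hJ.comp_homeomorph quarterTurn (fun p => ?_) p)
    · refine (natCast_cpow_analyticAt hn
        ((analyticAt_fst.add analyticAt_snd).sub analyticAt_const)).mul (.mul ?_ ?_)
      · exact AnalyticAt.fun_comp (g := fun s => (Complex.Gamma s)⁻¹) (f := Prod.snd)
          (analyticAt_inv_Gamma p.2) analyticAt_snd
      · have : Differentiable ℂ (fun w : ℂ => (-ε * Complex.I) ^ w) :=
          differentiable_id.const_cpow (Or.inl (neg_sign_mul_I_ne_zero hε))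
        exact AnalyticAt.fun_comp (this.analyticAt p.2) analyticAt_snd
    · exact analyticAt_snd.prod (analyticAt_const.sub analyticAt_fst)
  · intro s hs
    have e : J (quarterTurn s) = ∫ a, psiKernel n ε s a ∂psiMeasure := hJe (s.2, 1 - s.1) hs
    dsimp only
    rw [FSeries, (hasSum_FTerm hn hε hs).tsum_eq, (hasSum_Psi hn hε hs).tsum_eq, e]
    ring

/-! ### Rotation of the ray of integration -/

theorem integrable_exp_neg_mul_abs {δ : ℝ} (hδ : 0 < δ) :
    Integrable fun v : ℝ => Real.exp (-δ * |v|) := by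
  rw [← integrableOn_univ, ← Set.Iic_union_Ioi (a := (0 : ℝ))]
  refine IntegrableOn.union ?_ ?_
  · refine (integrableOn_exp_mul_Iic hδ 0).congr_fun (fun v hv => ?_) measurableSet_Iic
    dsimp only
    rw [abs_of_nonpos hv, neg_mul_neg]
  · refine (exp_neg_integrableOn_Ioi 0 hδ).congr_fun (fun v hv => ?_) measurableSet_Ioi
    dsimp only
    rw [abs_of_pos hv]

/-- The line of integration of a holomorphic function on a horizontal strip can be moved across the
strip if the function decays exponentially, uniformly on the strip. -/
theorem integral_horizontal_shift {G : ℂ → ℂ} {θ C δ : ℝ} (hδ : 0 < δ)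
    (hG : ∀ z : ℂ, z.im ∈ Set.uIcc 0 θ → DifferentiableAt ℂ G z)
    (hb : ∀ z : ℂ, z.im ∈ Set.uIcc 0 θ → ‖G z‖ ≤ C * Real.exp (-δ * |z.re|)) :
    ∫ v : ℝ, G (v + θ * Complex.I) = ∫ v : ℝ, G v := by
  have hint : ∀ η ∈ Set.uIcc 0 θ, Integrable fun v : ℝ => G (v + η * Complex.I) := by
    intro η hη
    have hc : Continuous fun v : ℝ => G (v + η * Complex.I) := by
      rw [continuous_iff_continuousAt]
      intro v
      refine ContinuousAt.comp (f := fun v : ℝ => (v + η * Complex.I : ℂ)) ?_ (by fun_prop)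
      exact (hG _ (by simpa using hη)).continuousAt
    refine ((integrable_exp_neg_mul_abs hδ).const_mul C).mono' hc.aestronglyMeasurable
      (Eventually.of_forall fun v => ?_)
    simpa using hb (v + η * Complex.I) (by simpa using hη)
  have hside : ∀ (σ : ℝ → ℝ), (∀ T, |σ T| = |T|) →
      Tendsto (fun T : ℝ => Complex.I • ∫ y in (0 : ℝ)..θ, G ((σ T : ℝ) + y * Complex.I))
        atTop (𝓝 0) := by
    intro σ hσ
    have hlim : Tendsto (fun T : ℝ => C * Real.exp (-δ * |T|) * |θ - 0|) atTop (𝓝 0) := by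
      have h1 : Tendsto (fun T : ℝ => Real.exp (-δ * |T|)) atTop (𝓝 0) := by
        refine Real.tendsto_exp_atBot.comp ?_
        exact tendsto_abs_atTop_atTop.const_mul_atTop_of_neg (by linarith)
      have := (h1.const_mul C).mul_const |θ - 0|
      rwa [mul_zero, zero_mul] at this
    refine squeeze_zero_norm (fun T => ?_) hlim
    rw [norm_smul, Complex.norm_I, one_mul]
    refine intervalIntegral.norm_integral_le_of_norm_le_const fun y hy => ?_
    have := hb ((σ T : ℝ) + y * Complex.I) (by simpa using Set.uIoc_subset_uIcc hy)
    simpa [hσ] using this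
  have hrect : ∀ T : ℝ, (((∫ v : ℝ in (-T)..T, G (v + (0 : ℝ) * Complex.I)) -
      ∫ v : ℝ in (-T)..T, G (v + θ * Complex.I)) +
        Complex.I • ∫ y : ℝ in (0 : ℝ)..θ, G ((T : ℝ) + y * Complex.I)) -
        Complex.I • ∫ y : ℝ in (0 : ℝ)..θ, G ((-T : ℝ) + y * Complex.I) = 0 := by
    intro T
    have := Complex.integral_boundary_rect_eq_zero_of_differentiableOn G ((-T : ℝ) : ℂ)
      ((T : ℝ) + θ * Complex.I) (fun z hz => (hG z (by simpa using hz.2)).differentiableWithinAt)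
    simpa using this
  have h1 := intervalIntegral_tendsto_integral (hint 0 Set.left_mem_uIcc)
    tendsto_neg_atTop_atBot tendsto_id
  have h2 := intervalIntegral_tendsto_integral (hint θ Set.right_mem_uIcc)
    tendsto_neg_atTop_atBot tendsto_id
  have h3 := ((h1.sub h2).add (hside id fun _ => rfl)).sub (hside Neg.neg abs_neg)
  have h4 := tendsto_nhds_unique (h3.congr fun T => hrect T) tendsto_const_nhds
  rw [add_zero, sub_zero, sub_eq_zero] at h4
  simpa using h4.symm

/-- The integrand `e^{-xy} y^{a-1} (1+y)^{-β} dy` in the logarithmic coordinate `y = e ^ z`. -/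
def logIntegrand (a β x z : ℂ) : ℂ :=
  Complex.exp (-x * Complex.exp z) * Complex.exp (z * a) * (1 + Complex.exp z) ^ (-β)

theorem re_exp_nonneg {z : ℂ} (hz : |z.im| ≤ Real.pi / 2) : 0 ≤ (Complex.exp z).re := by
  rw [Complex.exp_re]
  exact mul_nonneg (Real.exp_pos _).le
    (Real.cos_nonneg_of_neg_pi_div_two_le_of_le (abs_le.1 hz).1 (abs_le.1 hz).2)

theorem differentiableAt_logIntegrand (a β x : ℂ) {z : ℂ} (hz : |z.im| ≤ Real.pi / 2) :
    DifferentiableAt ℂ (logIntegrand a β x) z := by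
  unfold logIntegrand
  refine DifferentiableAt.mul (by fun_prop) ?_
  exact DifferentiableAt.cpow_const (by fun_prop) (one_add_mem_slitPlane (re_exp_nonneg hz))

/-- On the part of the strip where `e ^ z` and `x e ^ z` have nonnegative real part, the integrand decays
exponentially at both ends: like `e ^ (a Re z)` on the left because `1 + e ^ z` is bounded below by
`1`, and like `e ^ ((a - β) Re z)` on the right because it is bounded below by `e ^ (Re z)`. -/
theorem norm_logIntegrand_le {a β : ℂ} (ha : 0 < a.re) (haβ : a.re < β.re) :
    ∃ C δ : ℝ, 0 < δ ∧ ∀ x z : ℂ, |z.im| ≤ Real.pi / 2 → 0 ≤ (x * Complex.exp z).re →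
      ‖logIntegrand a β x z‖ ≤ C * Real.exp (-δ * |z.re|) := by
  refine ⟨Real.exp (Real.pi * ‖a‖) * Real.exp (Real.pi * ‖β‖), min a.re (β.re - a.re),
    lt_min ha (by linarith), fun x z hz hx => ?_⟩
  set δ := min a.re (β.re - a.re)
  have hδ1 : δ ≤ a.re := min_le_left _ _
  have hδ2 : δ ≤ β.re - a.re := min_le_right _ _
  have hE := re_exp_nonneg hz
  have n1 : 1 ≤ ‖1 + Complex.exp z‖ := (one_le_one_add_re hE).trans (Complex.re_le_norm _)
  have n2 : Real.exp z.re ≤ ‖1 + Complex.exp z‖ := by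
    rw [← Complex.norm_exp]
    refine abs_le_of_sq_le_sq' ?_ (norm_nonneg _) |>.2
    rw [← Complex.normSq_eq_norm_sq, ← Complex.normSq_eq_norm_sq, Complex.normSq_apply,
      Complex.normSq_apply]
    simp only [Complex.add_re, Complex.one_re, Complex.add_im, Complex.one_im, zero_add]
    nlinarith
  have e1 : ‖Complex.exp (-x * Complex.exp z)‖ ≤ 1 := by
    rw [Complex.norm_exp, Real.exp_le_one_iff, neg_mul, Complex.neg_re]
    linarith
  have e2 : ‖Complex.exp (z * a)‖ ≤ Real.exp (Real.pi * ‖a‖) * Real.exp (z.re * a.re) := by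
    rw [Complex.norm_exp, ← Real.exp_add, Complex.mul_re]
    refine Real.exp_le_exp.2 ?_
    have : -(z.im * a.im) ≤ Real.pi * ‖a‖ := by
      refine (neg_le_abs _).trans ?_
      rw [abs_mul]
      refine mul_le_mul (hz.trans (by linarith [Real.pi_pos])) (Complex.abs_im_le_norm a)
        (abs_nonneg _) Real.pi_pos.le
    linarith
  have e3 : ‖(1 + Complex.exp z) ^ (-β)‖ ≤
      Real.exp (Real.pi * ‖β‖) * ‖1 + Complex.exp z‖ ^ (-β.re) := by
    refine (Complex.norm_cpow_le _ _).trans ?_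
    rw [div_eq_mul_inv, ← Real.exp_neg, mul_comm, Complex.neg_re]
    refine mul_le_mul_of_nonneg_right (Real.exp_le_exp.2 ?_) (by positivity)
    refine (neg_le_abs _).trans ?_
    rw [abs_mul]
    refine mul_le_mul (Complex.abs_arg_le_pi _) ?_ (abs_nonneg _) Real.pi_pos.le
    rw [Complex.neg_im, abs_neg]
    exact Complex.abs_im_le_norm β
  have e4 : Real.exp (z.re * a.re) * ‖1 + Complex.exp z‖ ^ (-β.re) ≤ Real.exp (-δ * |z.re|) := by
    rcases le_total 0 z.re with h | h
    · have : ‖1 + Complex.exp z‖ ^ (-β.re) ≤ Real.exp z.re ^ (-β.re) :=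
        Real.rpow_le_rpow_of_nonpos (Real.exp_pos _) n2 (by linarith)
      refine (mul_le_mul_of_nonneg_left this (Real.exp_pos _).le).trans ?_
      rw [← Real.exp_mul, ← Real.exp_add, abs_of_nonneg h]
      refine Real.exp_le_exp.2 ?_
      nlinarith
    · have : ‖1 + Complex.exp z‖ ^ (-β.re) ≤ 1 :=
        Real.rpow_le_one_of_one_le_of_nonpos n1 (by linarith)
      refine (mul_le_mul_of_nonneg_left this (Real.exp_pos _).le).trans ?_
      rw [abs_of_nonpos h, mul_one]
      refine Real.exp_le_exp.2 ?_
      nlinarith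
  rw [logIntegrand, norm_mul, norm_mul]
  calc ‖Complex.exp (-x * Complex.exp z)‖ * ‖Complex.exp (z * a)‖ * ‖(1 + Complex.exp z) ^ (-β)‖
      ≤ 1 * (Real.exp (Real.pi * ‖a‖) * Real.exp (z.re * a.re)) *
        (Real.exp (Real.pi * ‖β‖) * ‖1 + Complex.exp z‖ ^ (-β.re)) := by gcongr
    _ = Real.exp (Real.pi * ‖a‖) * Real.exp (Real.pi * ‖β‖) *
        (Real.exp (z.re * a.re) * ‖1 + Complex.exp z‖ ^ (-β.re)) := by ring
    _ ≤ _ := by gcongr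

/-- The Laplace-type integral `∫₀^∞ e^{-xt} t^{a-1} (1+t)^{-β} dt` along the positive real axis. -/
def realRayIntegral (a β x : ℂ) : ℂ :=
  ∫ t in Set.Ioi (0 : ℝ), Complex.exp (-x * t) * (t : ℂ) ^ (a - 1) * (1 + t : ℂ) ^ (-β)

theorem realRayIntegral_eq (a β x : ℂ) :
    realRayIntegral a β x = ∫ v : ℝ, logIntegrand a β x v := by
  rw [realRayIntegral, integral_Ioi_eq_integral_exp _ one_pos]
  refine integral_congr_ae (Eventually.of_forall fun v => ?_)
  simp only [one_mul, logIntegrand]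
  have := ofReal_cpow_sub_one_mul (Real.exp_pos v) a
  rw [ofReal_cpow_eq_exp (Real.exp_pos v) a, Real.log_exp] at this
  rw [← this]
  push_cast
  ring

theorem neg_sign_mul_I_eq_exp {ε : ℝ} (hε : ε = 1 ∨ ε = -1) :
    -(ε : ℂ) * Complex.I = Complex.exp (((-ε * (Real.pi / 2) : ℝ) : ℂ) * Complex.I) := by
  rcases hε with rfl | rfl
  · push_cast
    rw [show -1 * ((Real.pi : ℂ) / 2) * Complex.I = -(Real.pi / 2 * Complex.I) by ring,
      Complex.exp_neg, Complex.exp_pi_div_two_mul_I, Complex.inv_I]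
    ring
  · push_cast
    rw [show - -1 * ((Real.pi : ℂ) / 2) * Complex.I = Real.pi / 2 * Complex.I by ring,
      Complex.exp_pi_div_two_mul_I]
    ring

theorem integral_psiIntegrand_eq_logIntegrand {ε : ℝ} (hε : ε = 1 ∨ ε = -1) (a b : ℂ) {l : ℕ}
    (hl : 1 ≤ l) : ∫ t in Set.Ioi (0 : ℝ), psiIntegrand a b (psiPoint ε l) t =
      ∫ v : ℝ, logIntegrand a (a + 1 - b) (psiPoint ε l)
        (v + ((-ε * (Real.pi / 2) : ℝ) : ℂ) * Complex.I) := by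
  have hε' : (ε : ℂ) = 1 ∨ (ε : ℂ) = -1 := by
    rcases hε with rfl | rfl <;> simp
  rw [integral_Ioi_eq_integral_exp _ one_pos]
  refine integral_congr_ae (Eventually.of_forall fun v => ?_)
  simp only [psiIntegrand, exp_neg_arg_psiPoint hε' hl, neg_sign_mul_I_eq_exp hε, one_mul,
    logIntegrand]
  set θ := -ε * (Real.pi / 2) with hθ
  set z : ℂ := v + (θ : ℂ) * Complex.I with hz
  have hE : Complex.exp (θ * Complex.I) * ((Real.exp v : ℝ) : ℂ) = Complex.exp z := by
    rw [hz, Complex.ofReal_exp, ← Complex.exp_add, add_comm]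
  have him : z.im = θ := by simp [hz]
  have hlog : Complex.log (Complex.exp z) = z := by
    refine Complex.log_exp ?_ ?_ <;> rw [him, hθ] <;> rcases hε with rfl | rfl <;>
      linarith [Real.pi_pos]
  have hpow : Complex.exp z ^ (a - 1) * Complex.exp z = Complex.exp (z * a) := by
    rw [Complex.cpow_def_of_ne_zero (Complex.exp_ne_zero _), hlog, ← Complex.exp_add]
    ring_nf
  rw [hE, ← hpow, show b - a - 1 = -(a + 1 - b) by ring, add_comm (Complex.exp z) 1]
  linear_combination (Complex.exp (-psiPoint ε l * Complex.exp z) *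
    Complex.exp z ^ (a - 1) * (1 + Complex.exp z) ^ (-(a + 1 - b))) * hE

/-- The ray of integration in `Ψ(a, b; ± 2π i l)` can be rotated to the positive real axis, where
the integral converges because of the power of `1 + t`. -/
theorem Gamma_mul_Psi_eq {ε : ℝ} (hε : ε = 1 ∨ ε = -1) {a b : ℂ} (ha : 0 < a.re) (hb : b.re < 1)
    {l : ℕ} (hl : 1 ≤ l) : Complex.Gamma a * Psi a b (psiPoint ε l) =
      realRayIntegral a (a + 1 - b) (psiPoint ε l) := by
  obtain ⟨C, δ, hδ, hbound⟩ := norm_logIntegrand_le (a := a) (β := a + 1 - b) ha (by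
    simp only [Complex.sub_re, Complex.add_re, Complex.one_re]
    linarith)
  have him : ∀ y ∈ Set.uIcc 0 (-ε * (Real.pi / 2)), |y| ≤ Real.pi / 2 ∧ ε * Real.sin y ≤ 0 := by
    intro y hy
    have hpi := Real.pi_pos
    rcases hε with rfl | rfl
    · rw [Set.uIcc_of_ge (by linarith)] at hy
      have h1 : -(Real.pi / 2) ≤ y := by linarith [hy.1]
      refine ⟨abs_le.2 ⟨h1, by linarith [hy.2]⟩, ?_⟩
      rw [one_mul]
      exact Real.sin_nonpos_of_nonpos_of_neg_pi_le hy.2 (by linarith)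
    · rw [Set.uIcc_of_le (by linarith)] at hy
      have h1 : y ≤ Real.pi / 2 := by linarith [hy.2]
      refine ⟨abs_le.2 ⟨by linarith [hy.1], h1⟩, ?_⟩
      have := Real.sin_nonneg_of_nonneg_of_le_pi hy.1 (by linarith)
      linarith
  have hre : ∀ z : ℂ, z.im ∈ Set.uIcc 0 (-ε * (Real.pi / 2)) →
      0 ≤ (psiPoint ε l * Complex.exp z).re := by
    intro z hz
    have h1 := (him _ hz).2
    have hl' := two_pi_mul_pos hl
    have e : (psiPoint ε l * Complex.exp z).re =
        (2 * Real.pi * l * Real.exp z.re) * -(ε * Real.sin z.im) := by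
      have : psiPoint ε l = ((ε * (2 * Real.pi * l) : ℝ) : ℂ) * Complex.I := by
        rw [psiPoint]; push_cast; ring
      rw [this, mul_assoc, Complex.re_ofReal_mul, Complex.I_mul_re, Complex.exp_im]
      ring
    rw [e]
    have := Real.exp_pos z.re
    exact mul_nonneg (by positivity) (by linarith)
  have hshift := integral_horizontal_shift (G := logIntegrand a (a + 1 - b) (psiPoint ε l)) hδ
    (fun z hz => differentiableAt_logIntegrand _ _ _ (him _ hz).1)
    (fun z hz => hbound _ z (him _ hz).1 (hre z hz))
  have hG : Complex.Gamma a ≠ 0 := Complex.Gamma_ne_zero_of_re_pos ha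
  rw [Psi, ← mul_assoc, mul_one_div_cancel hG, one_mul,
    integral_psiIntegrand_eq_logIntegrand hε a b hl, hshift, realRayIntegral_eq]

/-- Euler's integral of the first kind on the half-line. -/
theorem realRayIntegral_zero {a β : ℂ} (ha : 0 < a.re) (haβ : a.re < β.re) :
    realRayIntegral a β 0 = Complex.Gamma a * Complex.Gamma (β - a) / Complex.Gamma β := by
  have hv : 0 < (β - a).re := by simpa using haβ
  have h := Complex.betaIntegral_eq_Gamma_mul_div a (β - a) ha hv
  rw [add_sub_cancel] at h
  have himage : (fun t : ℝ => t / (1 + t)) '' Set.Ioi 0 = Set.Ioo 0 1 := by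
    ext y
    simp only [Set.mem_image, Set.mem_Ioi, Set.mem_Ioo]
    constructor
    · rintro ⟨t, ht, rfl⟩
      exact ⟨by positivity, by rw [div_lt_one (by positivity)]; linarith⟩
    · rintro ⟨h0, h1⟩
      have h2 : 0 < 1 - y := by linarith
      exact ⟨y / (1 - y), by positivity, by field_simp; ring⟩
  have hinj : Set.InjOn (fun t : ℝ => t / (1 + t)) (Set.Ioi 0) := by
    intro t ht t' ht' htt
    have h1 : (0 : ℝ) < 1 + t := by linarith [Set.mem_Ioi.1 ht]
    have h2 : (0 : ℝ) < 1 + t' := by linarith [Set.mem_Ioi.1 ht']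
    have := (div_eq_div_iff h1.ne' h2.ne').1 htt
    linarith
  rw [← h, Complex.betaIntegral, intervalIntegral.integral_of_le zero_le_one,
    integral_Ioc_eq_integral_Ioo, ← himage,
    integral_image_eq_integral_abs_deriv_smul measurableSet_Ioi (f' := fun t => 1 / (1 + t) ^ 2)
      (fun t ht => ?_) hinj, realRayIntegral]
  · refine setIntegral_congr_fun measurableSet_Ioi fun t ht => ?_
    have ht0 : 0 < t := ht
    have h1 : 0 < 1 + t := by linarith
    have e1 : (1 : ℂ) - ((t / (1 + t) : ℝ) : ℂ) = ((1 / (1 + t) : ℝ) : ℂ) := by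
      rw [← Complex.ofReal_one, ← Complex.ofReal_sub]
      congr 1
      field_simp
      ring
    have e2 : (1 + t : ℂ) = ((1 + t : ℝ) : ℂ) := by push_cast; ring
    have e3 : ((1 / (1 + t) ^ 2 : ℝ) : ℂ) = Complex.exp (-2 * Real.log (1 + t)) := by
      rw [← Real.exp_log (by positivity : 0 < 1 / (1 + t) ^ 2), one_div, Real.log_inv,
        Real.log_pow]
      push_cast
      ring_nf
    rw [abs_of_pos (by positivity), Complex.real_smul, e1, e2, e3, neg_zero, zero_mul,
      Complex.exp_zero, one_mul, ofReal_cpow_eq_exp ht0, ofReal_cpow_eq_exp h1,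
      ofReal_cpow_eq_exp (by positivity), ofReal_cpow_eq_exp (by positivity),
      Real.log_div ht0.ne' h1.ne', one_div, Real.log_inv, ← Complex.exp_add, ← Complex.exp_add,
      ← Complex.exp_add]
    push_cast
    ring_nf
  · have h1 : (1 + t) ≠ 0 := by linarith [Set.mem_Ioi.1 ht]
    have := (hasDerivAt_id t).div ((hasDerivAt_id t).const_add 1) h1
    refine (this.congr_deriv ?_).hasDerivWithinAt
    simp

/-! ### Poisson summation -/

/-- The function `y ↦ y ^ (-s₁) (y + n) ^ (-s₂)` on `y > 0`, extended by zero. -/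
def powerProduct (n : ℕ) (s : ℂ × ℂ) (y : ℝ) : ℂ :=
  ((max y 0 : ℝ) : ℂ) ^ (-s.1) * ((max y 0 + n : ℝ) : ℂ) ^ (-s.2)

theorem powerProduct_of_pos {n : ℕ} (s : ℂ × ℂ) {y : ℝ} (hy : 0 < y) :
    powerProduct n s y = (y : ℂ) ^ (-s.1) * ((y + n : ℝ) : ℂ) ^ (-s.2) := by
  rw [powerProduct, max_eq_left hy.le]

theorem powerProduct_of_nonpos {n : ℕ} {s : ℂ × ℂ} (hs : s.1.re < 0) {y : ℝ} (hy : y ≤ 0) :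
    powerProduct n s y = 0 := by
  have : -s.1 ≠ 0 := fun h => by simp [neg_eq_zero.1 h] at hs
  rw [powerProduct, max_eq_right hy, Complex.ofReal_zero, Complex.zero_cpow this, zero_mul]

theorem continuous_powerProduct {n : ℕ} (hn : 1 ≤ n) {s : ℂ × ℂ} (hs : s.1.re < 0) :
    Continuous (powerProduct n s) := by
  have hmax : Continuous fun y : ℝ => max y 0 := continuous_id.max continuous_const
  refine Continuous.mul ?_ ?_
  · exact (Complex.continuous_ofReal_cpow_const (by simpa using hs)).comp hmax
  · refine Continuous.cpow (by fun_prop) continuous_const fun y => ?_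
    have : (0 : ℝ) < n := by exact_mod_cast hn
    exact Complex.ofReal_mem_slitPlane.2 (add_pos_of_nonneg_of_pos (le_max_right _ _) this)

theorem norm_powerProduct_le {n : ℕ} (hn : 1 ≤ n) {s : ℂ × ℂ} (hs : s.1.re < 0)
    (hs2 : 0 ≤ s.2.re) (y : ℝ) : ‖powerProduct n s y‖ ≤ |y| ^ (-(s.1 + s.2).re) := by
  rcases le_or_gt y 0 with hy | hy
  · rw [powerProduct_of_nonpos hs hy, norm_zero]
    positivity
  · have hn' : (0 : ℝ) < n := by exact_mod_cast hn
    rw [powerProduct_of_pos s hy, norm_mul, Complex.norm_cpow_eq_rpow_re_of_pos hy,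
      Complex.norm_cpow_eq_rpow_re_of_pos (add_pos hy hn'), abs_of_pos hy, Complex.add_re, neg_add,
      Real.rpow_add hy, Complex.neg_re, Complex.neg_re]
    exact mul_le_mul_of_nonneg_left
      (Real.rpow_le_rpow_of_nonpos hy (by linarith) (by linarith)) (by positivity)

open FourierTransform in
/-- The substitution `y = n t` in the Fourier integral. -/
theorem fourier_powerProduct {n : ℕ} (hn : 1 ≤ n) {s : ℂ × ℂ} (hs : s.1.re < 0) (ξ : ℝ) :
    𝓕 (powerProduct n s) ξ = (n : ℂ) ^ (1 - s.1 - s.2) *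
      realRayIntegral (1 - s.1) s.2 (2 * Real.pi * Complex.I * ξ * n) := by
  have hn' : (0 : ℝ) < n := by exact_mod_cast hn
  rw [Real.fourier_real_eq_integral_exp_smul]
  rw [← setIntegral_eq_integral_of_forall_compl_eq_zero (s := Set.Ioi 0) (fun y hy => by
    rw [powerProduct_of_nonpos hs (not_lt.1 hy), smul_zero])]
  have hsc := integral_comp_mul_left_Ioi (fun y : ℝ =>
    Complex.exp (((-2 * Real.pi * y * ξ : ℝ) : ℂ) * Complex.I) • powerProduct n s y) 0 hn'
  rw [mul_zero, eq_inv_smul_iff₀ hn'.ne'] at hsc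
  rw [← hsc, realRayIntegral, ← integral_const_mul, ← integral_smul]
  refine setIntegral_congr_fun measurableSet_Ioi fun t ht => ?_
  have ht0 : 0 < t := ht
  have hnt : 0 < (n : ℝ) * t := by positivity
  have h1 : 0 < 1 + t := by linarith
  have e2 : (1 + t : ℂ) = ((1 + t : ℝ) : ℂ) := by push_cast; ring
  have e3 : (n : ℝ) * t + n = n * (1 + t) := by ring
  have e4 : (n : ℂ) ^ (1 - s.1 - s.2) = Complex.exp (Real.log n * (1 - s.1 - s.2)) := by
    simpa using ofReal_cpow_eq_exp hn' (1 - s.1 - s.2)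
  have e5 : ((n : ℝ) : ℂ) = Complex.exp (Real.log n) := by
    rw [← Complex.ofReal_exp, Real.exp_log hn']
  rw [powerProduct_of_pos s hnt, e2, e3, Complex.real_smul, smul_eq_mul, ofReal_cpow_eq_exp hnt,
    ofReal_cpow_eq_exp (by positivity), ofReal_cpow_eq_exp ht0, ofReal_cpow_eq_exp h1, e4,
    Real.log_mul hn'.ne' ht0.ne', Real.log_mul hn'.ne' h1.ne']
  nth_rewrite 1 [e5]
  rw [← Complex.exp_add, ← Complex.exp_add, ← Complex.exp_add, ← Complex.exp_add,
    ← Complex.exp_add, ← Complex.exp_add]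
  push_cast
  ring_nf

open FourierTransform in
theorem fourier_powerProduct_zero {n : ℕ} (hn : 1 ≤ n) {s : ℂ × ℂ} (hs : s.1.re < 0)
    (hs2 : 1 < (s.1 + s.2).re) : 𝓕 (powerProduct n s) ((0 : ℤ) : ℝ) =
      (n : ℂ) ^ (1 - s.1 - s.2) * (Complex.Gamma (1 - s.1) * Complex.Gamma (s.1 + s.2 - 1) /
        Complex.Gamma s.2) := by
  rw [Complex.add_re] at hs2
  rw [fourier_powerProduct hn hs, Int.cast_zero, Complex.ofReal_zero, mul_zero, zero_mul,
    realRayIntegral_zero (by simp only [Complex.sub_re, Complex.one_re]; linarith)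
      (by simp only [Complex.sub_re, Complex.one_re]; linarith),
    show s.2 - (1 - s.1) = s.1 + s.2 - 1 by ring]

open FourierTransform in
theorem fourier_powerProduct_int {n : ℕ} (hn : 1 ≤ n) {s : ℂ × ℂ} (hs : s.1.re < 0)
    (hs2 : 1 < (s.1 + s.2).re) {ε : ℝ} (hε : ε = 1 ∨ ε = -1) (k : ℕ+) :
    𝓕 (powerProduct n s) (ε * k) = (n : ℂ) ^ (1 - s.1 - s.2) * (Complex.Gamma (1 - s.1) *
      Psi (1 - s.1) (1 - s.2 + (1 - s.1)) (psiPoint ε ((k : ℕ) * n))) := by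
  rw [Complex.add_re] at hs2
  rw [Gamma_mul_Psi_eq hε (by simp only [Complex.sub_re, Complex.one_re]; linarith)
    (by simp only [Complex.sub_re, Complex.add_re, Complex.one_re]; linarith)
    (one_le_pnat_mul hn k), fourier_powerProduct hn hs,
    show 1 - s.1 + 1 - (1 - s.2 + (1 - s.1)) = s.2 by ring]
  congr 2
  rw [psiPoint]
  push_cast
  ring

/-- The functional equation where all the series converge, as a case of Poisson's summation formula;
the frequency zero contributes the quotient of Gamma functions. -/
theorem functional_equation_of_convergent {n : ℕ} (hn : 1 ≤ n) {s : ℂ × ℂ} (hs : s.1.re < 0)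
    (hs2 : 1 < (s.1 + s.2).re) : L2Series (A0 n) s =
      Complex.Gamma (1 - s.1) * Complex.Gamma (s.1 + s.2 - 1) / Complex.Gamma s.2 *
        (1 / (n : ℂ) ^ (s.1 + s.2 - 1)) + Complex.Gamma (1 - s.1) *
          (FSeries (A0 n) 1 (1 - s.2, 1 - s.1) + FSeries (A0 n) (-1) (1 - s.2, 1 - s.1)) := by
  have hF : ((1 - s.2, 1 - s.1) : ℂ × ℂ) ∈ regionF := by
    simp only [regionF, Set.mem_ofPred_eq, Complex.sub_re, Complex.one_re]
    linarith
  have hs2' : 0 ≤ s.2.re := by rw [Complex.add_re] at hs2; linarith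
  have hp := fun k : ℕ+ => fourier_powerProduct_int hn hs hs2 (Or.inl rfl : (1 : ℝ) = 1 ∨ _) k
  have hm := fun k : ℕ+ => fourier_powerProduct_int hn hs hs2 (Or.inr rfl : _ ∨ (-1 : ℝ) = -1) k
  simp only [one_mul, neg_mul, Complex.ofReal_one, Complex.ofReal_neg] at hp hm
  have sp := (((hasSum_Psi hn (Or.inl rfl) hF).summable.mul_left
    (Complex.Gamma (1 - s.1))).mul_left ((n : ℂ) ^ (1 - s.1 - s.2))).congr fun k => (hp k).symm
  have sm := (((hasSum_Psi hn (Or.inr rfl) hF).summable.mul_left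
    (Complex.Gamma (1 - s.1))).mul_left ((n : ℂ) ^ (1 - s.1 - s.2))).congr fun k => (hm k).symm
  have hsum : Summable fun k : ℤ => FourierTransform.fourier (powerProduct n s) (k : ℝ) := by
    rw [summable_int_iff_summable_nat_and_neg]
    constructor
    · refine (summable_pnat_iff_summable_nat
        (f := fun k : ℕ => FourierTransform.fourier (powerProduct n s) ((k : ℤ) : ℝ))).1 ?_
      simpa using sp
    · refine (summable_pnat_iff_summable_nat
        (f := fun k : ℕ => FourierTransform.fourier (powerProduct n s) ((-(k : ℤ) : ℤ) : ℝ))).1 ?_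
      simpa using sm
  have hO : powerProduct n s =O[cocompact ℝ] fun y : ℝ => |y| ^ (-(s.1 + s.2).re) := by
    refine Asymptotics.IsBigO.of_bound 1 (Eventually.of_forall fun y => ?_)
    rw [one_mul, Real.norm_eq_abs, abs_of_nonneg (by positivity)]
    exact norm_powerProduct_le hn hs hs2' y
  have hPoisson := Real.tsum_eq_tsum_fourier_of_rpow_decay_of_summable
    (continuous_powerProduct hn hs) hs2 hO hsum 0
  have hfour : ∀ k : ℤ, fourier k ((0 : ℝ) : UnitAddCircle) = (1 : ℂ) := fun k => by simp
  simp only [hfour, mul_one, zero_add] at hPoisson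
  have hinj : Function.Injective fun m : ℕ+ => ((m : ℕ) : ℤ) :=
    fun a b h => PNat.eq (Int.ofNat_inj.1 h)
  have hleft : ∑' k : ℤ, powerProduct n s k = L2Series (A0 n) s := by
    rw [← (hasSum_L2_row hn (show s ∈ regionL from hs2)).tsum_eq, ← hinj.tsum_eq]
    · refine tsum_congr fun m => ?_
      have hm0 : (0 : ℝ) < m := by exact_mod_cast m.pos
      rw [Int.cast_natCast, powerProduct_of_pos s hm0, Complex.cpow_neg, Complex.cpow_neg,
        one_div, mul_inv]
      push_cast
      rfl
    · intro k hk
      have hk0 : 0 < k := by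
        by_contra hcon
        exact hk (powerProduct_of_nonpos hs (by exact_mod_cast not_lt.1 hcon))
      exact ⟨⟨k.toNat, by omega⟩, by simpa using hk0.le⟩
  rw [hleft, tsum_int_eq_zero_add_tsum_pnat hsum, fourier_powerProduct_zero hn hs hs2] at hPoisson
  have hn0 : (n : ℂ) ≠ 0 := by exact_mod_cast (by omega : n ≠ 0)
  have hinv : (1 : ℂ) / (n : ℂ) ^ (s.1 + s.2 - 1) = (n : ℂ) ^ (1 - s.1 - s.2) := by
    rw [one_div, ← Complex.cpow_neg]
    congr 1
    ring
  have eF : ∀ ε : ℂ, ε = 1 ∨ ε = -1 → Complex.Gamma (1 - s.1) *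
      FSeries (A0 n) ε (1 - s.2, 1 - s.1) = ∑' k : ℕ+, (n : ℂ) ^ (1 - s.1 - s.2) *
        (Complex.Gamma (1 - s.1) *
          Psi (1 - s.1) (1 - s.2 + (1 - s.1)) (psiPoint ε ((k : ℕ) * n))) := by
    intro ε hε
    rw [FSeries, (hasSum_FTerm hn hε hF).tsum_eq, tsum_mul_left, tsum_mul_left]
    rw [show 1 - s.2 + (1 - s.1) - 1 = 1 - s.1 - s.2 by ring]
    ring
  rw [mul_add, eF 1 (Or.inl rfl), eF (-1) (Or.inr rfl), hinv, hPoisson]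
  simp only [Int.cast_neg, Int.cast_natCast, hp, hm]
  ring

/-! ### The functional equation -/

/-- The change of coordinates `(s₁, s₂) ↦ (1 - s₂, 1 - s₁)` of the functional equation. -/
def reflection : ℂ × ℂ ≃ₜ ℂ × ℂ where
  toFun s := (1 - s.2, 1 - s.1)
  invFun s := (1 - s.2, 1 - s.1)
  left_inv s := by simp
  right_inv s := by simp
  continuous_toFun := by fun_prop
  continuous_invFun := by fun_prop

theorem analyticAt_reflection (p : ℂ × ℂ) : AnalyticAt ℂ reflection p :=
  (analyticAt_const.sub analyticAt_snd).prod (analyticAt_const.sub analyticAt_fst)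

theorem isMeromorphic_Gamma_one_sub : IsMeromorphic fun s => Complex.Gamma (1 - s.1) := by
  have := isMeromorphic_comp_affine meromorphicAt_Gamma (-ContinuousLinearMap.fst ℂ ℂ ℂ) 1
    (v := (-1, 0)) (by simp)
  refine fun p => (this.near p).congr (Eventually.of_forall fun q => ?_)
  simp [sub_eq_neg_add]

theorem isMeromorphic_Gamma_add_sub_one :
    IsMeromorphic fun s => Complex.Gamma (s.1 + s.2 - 1) := by
  have := isMeromorphic_comp_affine meromorphicAt_Gamma
    (ContinuousLinearMap.fst ℂ ℂ ℂ + ContinuousLinearMap.snd ℂ ℂ ℂ) (-1) (v := (1, 0)) (by simp)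
  refine fun p => (this.near p).congr (Eventually.of_forall fun q => ?_)
  simp [sub_eq_add_neg]

/-- The functional equation for arbitrary meromorphic continuations: the difference of its two sides
is meromorphic on `ℂ²` and vanishes where all the series converge. -/
theorem functional_equation {n : ℕ} (hn : 1 ≤ n) {L Fp Fm : ℂ × ℂ → ℂ}
    (hL : IsMeromorphicContinuation (L2Series (A0 n)) regionL L)
    (hFp : IsMeromorphicContinuation (FSeries (A0 n) 1) regionF Fp)
    (hFm : IsMeromorphicContinuation (FSeries (A0 n) (-1)) regionF Fm) (s₁ s₂ : ℂ)
    (aL : AnalyticAt ℂ L (s₁, s₂)) (aFp : AnalyticAt ℂ Fp (1 - s₂, 1 - s₁))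
    (aFm : AnalyticAt ℂ Fm (1 - s₂, 1 - s₁)) (h1 : ∀ j : ℕ, 1 - s₁ ≠ -(j : ℂ))
    (h2 : ∀ j : ℕ, s₁ + s₂ - 1 ≠ -(j : ℂ)) :
    L (s₁, s₂) = Complex.Gamma (1 - s₁) * Complex.Gamma (s₁ + s₂ - 1) / Complex.Gamma s₂ *
        (1 / (n : ℂ) ^ (s₁ + s₂ - 1)) +
          Complex.Gamma (1 - s₁) * (Fp (1 - s₂, 1 - s₁) + Fm (1 - s₂, 1 - s₁)) := by
  have hn0 : (n : ℂ) ≠ 0 := by exact_mod_cast (by omega : n ≠ 0)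
  -- `1 / Γ(s₂)` and the power of `n` are entire, so they impose no condition on the point
  have ent : ∀ p : ℂ × ℂ, AnalyticAt ℂ
      (fun s : ℂ × ℂ => (Complex.Gamma s.2)⁻¹ * (n : ℂ) ^ (1 - s.1 - s.2)) p := fun p =>
    (AnalyticAt.fun_comp (g := fun z => (Complex.Gamma z)⁻¹) (f := Prod.snd)
      (analyticAt_inv_Gamma p.2) analyticAt_snd).mul
      (natCast_cpow_analyticAt hn ((analyticAt_const.sub analyticAt_fst).sub analyticAt_snd))
  let G : ℂ × ℂ → ℂ := fun s => L s + (-1) * (Complex.Gamma (1 - s.1) *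
    Complex.Gamma (s.1 + s.2 - 1) * ((Complex.Gamma s.2)⁻¹ * (n : ℂ) ^ (1 - s.1 - s.2)) +
      Complex.Gamma (1 - s.1) * (Fp (reflection s) + Fm (reflection s)))
  have hG : IsMeromorphic G := fun p =>
    IsMeromorphicNear.add (hL.1 p) <| analyticAt_const.isMeromorphicNear.mul <|
      IsMeromorphicNear.add
        (((isMeromorphic_Gamma_one_sub.near p).mul (isMeromorphic_Gamma_add_sub_one.near p)).mul
          (ent p).isMeromorphicNear)
        ((isMeromorphic_Gamma_one_sub.near p).mul <| IsMeromorphicNear.add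
          (hFp.1.comp_homeomorph reflection analyticAt_reflection p)
          (hFm.1.comp_homeomorph reflection analyticAt_reflection p))
  have hinv : ∀ s : ℂ × ℂ, (1 : ℂ) / (n : ℂ) ^ (s.1 + s.2 - 1) = (n : ℂ) ^ (1 - s.1 - s.2) := by
    intro s
    rw [one_div, ← Complex.cpow_neg]
    congr 1
    ring
  have hc1 : Continuous fun s : ℂ × ℂ => s.1.re := Complex.continuous_re.comp continuous_fst
  have hc2 : Continuous fun s : ℂ × ℂ => (s.1 + s.2).re :=
    Complex.continuous_re.comp (continuous_fst.add continuous_snd)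
  have hD : IsOpen {s : ℂ × ℂ | s.1.re < 0 ∧ 1 < (s.1 + s.2).re} :=
    (isOpen_lt hc1 continuous_const).inter (isOpen_lt continuous_const hc2)
  have hDne : {s : ℂ × ℂ | s.1.re < 0 ∧ 1 < (s.1 + s.2).re}.Nonempty :=
    ⟨(-1, 3), by norm_num⟩
  have h0 : ∀ s ∈ {s : ℂ × ℂ | s.1.re < 0 ∧ 1 < (s.1 + s.2).re}, G s = 0 := by
    rintro s ⟨hs, hs2⟩
    have hF : reflection s ∈ regionF := by
      change 1 < (1 - s.1).re
      rw [Complex.sub_re, Complex.one_re]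
      linarith
    have := functional_equation_of_convergent hn hs hs2
    rw [hinv] at this
    simp only [G]
    rw [hL.2 (show s ∈ regionL from hs2), hFp.2 hF, hFm.2 hF, this]
    change _ + (-1) * (_ + _ * (FSeries (A0 n) 1 (1 - s.2, 1 - s.1) +
      FSeries (A0 n) (-1) (1 - s.2, 1 - s.1))) = 0
    ring
  have hΓ1 : ContinuousAt (fun s : ℂ × ℂ => Complex.Gamma (1 - s.1)) (s₁, s₂) :=
    ContinuousAt.comp (f := fun s : ℂ × ℂ => 1 - s.1)
      (Complex.differentiableAt_Gamma _ h1).continuousAt (by fun_prop)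
  have hΓ2 : ContinuousAt (fun s : ℂ × ℂ => Complex.Gamma (s.1 + s.2 - 1)) (s₁, s₂) :=
    ContinuousAt.comp (f := fun s : ℂ × ℂ => s.1 + s.2 - 1)
      (Complex.differentiableAt_Gamma _ h2).continuousAt (by fun_prop)
  have hr : ContinuousAt reflection (s₁, s₂) := reflection.continuous.continuousAt
  have hGc : ContinuousAt G (s₁, s₂) :=
    aL.continuousAt.add (continuousAt_const.mul (((hΓ1.mul hΓ2).mul (ent _).continuousAt).add
      (hΓ1.mul ((ContinuousAt.comp (f := reflection) aFp.continuousAt hr).add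
        (ContinuousAt.comp (f := reflection) aFm.continuousAt hr)))))
  have := hG.eq_zero hD hDne h0 hGc
  have e := hinv (s₁, s₂)
  dsimp only at e
  have er : reflection (s₁, s₂) = (1 - s₂, 1 - s₁) := rfl
  simp only [G, er] at this
  rw [e]
  linear_combination this

end EulerDouble

end

theorem corollary1 (n : ℕ) (hn : 1 ≤ n) :
    -- the series `L₂(s₁, s₂; 𝔄₀(n))` converges absolutely and is a single series
    (∀ s ∈ EulerDouble.regionL,
      Summable (EulerDouble.L2Term (EulerDouble.A0 n) s) ∧
      HasSum (fun m : ℕ+ => 1 / ((m : ℂ) ^ s.1 * ((m : ℂ) + (n : ℂ)) ^ s.2))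
        (EulerDouble.L2Series (EulerDouble.A0 n) s)) ∧
    -- the integrals defining the functions `Ψ` converge absolutely
    (∀ ε : ℂ, ε = 1 ∨ ε = -1 → ∀ s : ℂ × ℂ, 0 < s.2.re → ∀ l : ℕ, 1 ≤ l →
      MeasureTheory.IntegrableOn
        (EulerDouble.psiIntegrand s.2 (s.1 + s.2) (EulerDouble.psiPoint ε l))
        (Set.Ioi (0 : ℝ))) ∧
    -- the series `F_±(s₁, s₂; 𝔄₀(n))` converge absolutely and have the explicit form
    (∀ ε : ℂ, ε = 1 ∨ ε = -1 → ∀ s ∈ EulerDouble.regionF,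
      Summable (EulerDouble.FTerm (EulerDouble.A0 n) ε s) ∧
      Summable (fun k : ℕ+ =>
        EulerDouble.Psi s.2 (s.1 + s.2) (EulerDouble.psiPoint ε ((k : ℕ) * n))) ∧
      EulerDouble.FSeries (EulerDouble.A0 n) ε s =
        (n : ℂ) ^ (s.1 + s.2 - 1) * ∑' k : ℕ+,
          EulerDouble.Psi s.2 (s.1 + s.2) (EulerDouble.psiPoint ε ((k : ℕ) * n))) ∧
    -- all of them have meromorphic continuations to `ℂ²`
    (∃ L : ℂ × ℂ → ℂ, EulerDouble.IsMeromorphicContinuation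
      (EulerDouble.L2Series (EulerDouble.A0 n)) EulerDouble.regionL L) ∧
    (∀ ε : ℂ, ε = 1 ∨ ε = -1 → ∃ F : ℂ × ℂ → ℂ, EulerDouble.IsMeromorphicContinuation
      (EulerDouble.FSeries (EulerDouble.A0 n) ε) EulerDouble.regionF F) ∧
    -- and the continued functions satisfy the functional equation off the singularities
    (∀ L Fp Fm : ℂ × ℂ → ℂ,
      EulerDouble.IsMeromorphicContinuation
        (EulerDouble.L2Series (EulerDouble.A0 n)) EulerDouble.regionL L →
      EulerDouble.IsMeromorphicContinuation
        (EulerDouble.FSeries (EulerDouble.A0 n) 1) EulerDouble.regionF Fp →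
      EulerDouble.IsMeromorphicContinuation
        (EulerDouble.FSeries (EulerDouble.A0 n) (-1)) EulerDouble.regionF Fm →
      ∀ s₁ s₂ : ℂ,
        AnalyticAt ℂ L (s₁, s₂) →
        AnalyticAt ℂ Fp (1 - s₂, 1 - s₁) →
        AnalyticAt ℂ Fm (1 - s₂, 1 - s₁) →
        (∀ j : ℕ, 1 - s₁ ≠ -(j : ℂ)) →
        (∀ j : ℕ, s₁ + s₂ - 1 ≠ -(j : ℂ)) →
        L (s₁, s₂) =
          Complex.Gamma (1 - s₁) * Complex.Gamma (s₁ + s₂ - 1) / Complex.Gamma s₂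
              * (1 / (n : ℂ) ^ (s₁ + s₂ - 1))
            + Complex.Gamma (1 - s₁) * (Fp (1 - s₂, 1 - s₁) + Fm (1 - s₂, 1 - s₁))) := by
  refine ⟨fun s hs => ⟨EulerDouble.summable_L2Term hn hs, EulerDouble.hasSum_L2_row hn hs⟩,
    fun ε hε s hs l hl => EulerDouble.integrableOn_psiIntegrand hε hs hl,
    fun ε hε s hs => ⟨(EulerDouble.hasSum_FTerm hn hε hs).summable,
      (EulerDouble.hasSum_Psi hn hε hs).summable, (EulerDouble.hasSum_FTerm hn hε hs).tsum_eq⟩,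
    EulerDouble.exists_continuation_L2 hn, fun ε hε => EulerDouble.exists_continuation_F hn hε, ?_⟩
  intro L Fp Fm hL hFp hFm s₁ s₂ aL aFp aFm h1 h2
  exact EulerDouble.functional_equation hn hL hFp hFm s₁ s₂ aL aFp aFm h1 h2
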